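/- Let $(\Gamma_h)_{h>0}$ be a family of locally finite planar graphs embedded into $\mathbb{C}$ with straight edges, with vertex sets $V_h\subset\mathbb{C}$ and edge sets $E_h$. Suppose that each $\Gamma_h$ is isoradial: every face of $\Gamma_h$ (every connected component of the complement of the drawing) is a polygon inscribed into a circle of diameter $h$ whose center lies inside the face. For $e=\{u,v\}\in E_h$ write $|e|=|u-v|$, and let $|e^*|$ be the length of the dual edge $e^*$, i.e. the distance between the circumcenters of the two faces adjacent to $e$. Assume that there are constants $c_p,c_d>0$ such that for all $h>0$ $$ c_p h\le \inf_{e\in E_h}|e| \quad\text{and}\quad c_d h\le \inf_{e\in E_h}|e^*| .$$ For $e=\{u,v\}\in E_h$ put $\omega_{uv}=|e^*|/|e|$, put $\omega_{uv}=0$ if $\{u,v\}\notin E_h$, and let $m_u=\sum_{z\sim u}\omega_{uz}$. Let $d_h^c$ be the combinatorial graph distance on $\Gamma_h$, $B_n^h(u)=\{v\in V_h: d_h^c(v,u)\le n\}$ and $\operatorname{vol}_h(u,n)=\sum_{v\in B_n^h(u)}m_v$. Then there are constants $c_1,c_2>0$, independent of $n$, $h$ and $u$, such that $$ c_1 n^2\le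 \operatorname{vol}_h(u,n)\le c_2 n^2 $$ for all integers $n\ge 1$, all $h>0$ and all $u\in V_h$. Moreover, there is a constant $C_P>0$, independent of $n$, $h$, $u$ and $f$, such that $$ \sum_{v\in B_n^h(u)} m_v\bigl(f(v)-\bar f_{B_n^h(u)}\bigr)^2\le C_P\,n^2\sum_{v,w\in B_{2n}^h(u)}\omega_{vw}\bigl(f(w)-f(v)\bigr)^2 $$ for all integers $n\ge 1$, all $h>0$, all $u\in V_h$ and all $f:V_h\to\mathbb{R}$, where $$ \bar f_{B_n^h(u)}=\frac{1}{\operatorname{vol}_h(u,n)}\sum_{v\in B_n^h(u)}m_v f(v). $$ -/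

import Mathlib

noncomputable section

/-- A planar graph embedded into `ℂ` with straight edges.  The vertices are points of `ℂ`, the edge
between adjacent `u` and `v` is drawn as the segment from `u` to `v`, no vertex lies in the
relative interior of an edge, different edges have disjoint relative interiors, and the drawing
is locally finite: a compact set meets only finitely many vertices and edges. -/
structure PlaneGraph where
  /-- the vertex set -/
  V : Set ℂ
  /-- the adjacency relation -/
  graph : SimpleGraph V
  vertex_notMem_edge : ∀ u v w : V, graph.Adj u v → (w : ℂ) ∉ openSegment ℝ (u : ℂ) v
  edges_disjoint : ∀ u v u' v' : V, graph.Adj u v → graph.Adj u' v' → s(u, v) ≠ s(u', v') →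
    Disjoint (openSegment ℝ (u : ℂ) v) (openSegment ℝ (u' : ℂ) v')
  finite_vertices : ∀ K : Set ℂ, IsCompact K → (V ∩ K).Finite
  finite_edges : ∀ K : Set ℂ, IsCompact K →
    {p : V × V | graph.Adj p.1 p.2 ∧ (segment ℝ (p.1 : ℂ) p.2 ∩ K).Nonempty}.Finite

namespace PlaneGraph

variable (Γ : PlaneGraph)

/-- The subset of the plane covered by the drawing: all vertices and all edges. -/
def skeleton : Set ℂ :=
  Γ.V ∪ {z | ∃ u v : Γ.V, Γ.graph.Adj u v ∧ z ∈ segment ℝ (u : ℂ) v}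

/-- The faces are the connected components of the complement of the drawing. -/
def faces : Set (Set ℂ) :=
  {f | ∃ z ∈ Γ.skeletonᶜ, f = connectedComponentIn Γ.skeletonᶜ z}

/-- The vertices of the graph on the boundary of a face. -/
def corners (f : Set ℂ) : Set ℂ := Γ.V ∩ frontier f

/-- The face `f` is an (open) polygon inscribed into a circle of diameter `h`, that is, `f` is
the interior of the convex hull of its corners and these lie on a circle of radius `h / 2`,
and the center of this circle lies inside `f`. -/
def IsoradialFace (h : ℝ) (f : Set ℂ) : Prop :=
  f = interior (convexHull ℝ (Γ.corners f)) ∧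
    ∃ c ∈ f, ∀ v ∈ Γ.corners f, dist v c = h / 2

/-- `Γ` is isoradial with circles of diameter `h`.  As this concerns all complementary
components, there is no unbounded face, and the closed faces tile the plane. -/
def IsIsoradial (h : ℝ) : Prop := ∀ f ∈ Γ.faces, Γ.IsoradialFace h f

/-- `c` is the center of a circle through all corners of `f`. -/
def IsCircumcenter (f : Set ℂ) (c : ℂ) : Prop := ∃ r : ℝ, ∀ v ∈ Γ.corners f, dist v c = r

/-- The endpoints of the dual edge `e*` of `e = {u, v}`: the circumcenters of the faces that have
`e` as a boundary edge.  In an isoradial graph these are exactly two points, one on each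
side of `e`. -/
def dualEnds (u v : Γ.V) : Set ℂ :=
  {c | ∃ f ∈ Γ.faces, openSegment ℝ (u : ℂ) v ⊆ frontier f ∧ Γ.IsCircumcenter f c}

/-- The Euclidean length `|e*|` of the dual edge of `e = {u, v}`, i.e. the distance between its two
endpoints. -/
def dualLength (u v : Γ.V) : ℝ := Metric.diam (Γ.dualEnds u v)

open Classical in
/-- The edge weight `ω_{uv} = |e*| / |e|` for an edge `e = {u, v}`, and `0` if `u`, `v` are not
adjacent. -/
def weight (u v : Γ.V) : ℝ :=
  if Γ.graph.Adj u v then Γ.dualLength u v / dist (u : ℂ) v else 0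

/-- The vertex weight `m_u = ∑_{z ∼ u} ω_{uz}`. -/
def mass (u : Γ.V) : ℝ := ∑ᶠ z ∈ Γ.graph.neighborSet u, Γ.weight u z

/-- The combinatorial ball of radius `n` around `u` (`edist` is the least number of edges of a
path, and `⊤` if there is no path). -/
def ball (u : Γ.V) (n : ℕ) : Set Γ.V := {v | Γ.graph.edist v u ≤ n}

/-- The volume of the combinatorial ball. -/
def vol (u : Γ.V) (n : ℕ) : ℝ := ∑ᶠ v ∈ Γ.ball u n, Γ.mass v

/-- The weighted mean of `f` over the combinatorial ball. -/
def mean (f : Γ.V → ℝ) (u : Γ.V) (n : ℕ) : ℝ :=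
  1 / Γ.vol u n * ∑ᶠ v ∈ Γ.ball u n, Γ.mass v * f v

end PlaneGraph

/-- The lengths of the edges of `Γ h` are at least a constant multiple of `h`. -/
def PrimalEdgeBound (Γ : ℝ → PlaneGraph) : Prop :=
  ∃ c : ℝ, 0 < c ∧ ∀ h : ℝ, 0 < h → ∀ u v : (Γ h).V, (Γ h).graph.Adj u v →
    c * h ≤ dist (u : ℂ) v

/-- The lengths of the dual edges of `Γ h` are at least a constant multiple of `h`. -/
def DualEdgeBound (Γ : ℝ → PlaneGraph) : Prop :=
  ∃ c : ℝ, 0 < c ∧ ∀ h : ℝ, 0 < h → ∀ u v : (Γ h).V, (Γ h).graph.Adj u v →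
    c * h ≤ (Γ h).dualLength u v

end

/-!
The theorem is a statement about graphs that are roughly isometric to the square lattice, with
uniform constants; the geometry only serves to put isoradial graphs into that class.

**Geometry.** A face is the interior of the convex hull of its corners, which lie on a circle around
an inner point. An edge with an inner point on the boundary of a face runs along a side of that face
(`PlaneGraph.edge_subset_side`): edges contain no vertices inside, and near an inner point of a side
the face fills a half-plane that the edge cannot enter. So edges have length at most `h`, and faces
whose closures meet share a corner (`PlaneGraph.IsIsoradial.exists_common_corner`). Conversely, a
chord of a face that no corner lies beyond is an edge (`PlaneGraph.adj_of_side`). As the center is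
inside the face, a corner beyond a chord is closer to both of its ends than these are to each other;
hence a closest pair of corners, or a closest pair from two classes of corners, is an edge
(`PlaneGraph.adj_of_closest`). Therefore the corners of a face have mutual distance at least the
lower bound `c_p h` for the length of edges, and carry a connected subgraph. By the formula for the
area of a triangle inscribed in a circle, each face contains a disc of radius comparable to `h`,
which bounds the number of vertices in a disc of radius `K h` (`PlaneGraph.exists_card_bound`). The
corners of the faces along a segment are connected to each other, so the graph distance is at most a
constant times `|u - v| / h + 1` (`PlaneGraph.exists_edist_bound`). With a grid of mesh `3 h` this
says that the graph is lattice-like (`IsLatticeLike`, `PlaneGraph.exists_isLatticeLike`). The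
weights of the edges lie between `c_d` and `1 / c_p`, as dual edges have length at most `h` and at
least `c_d h`.

**Analysis.** The volume bounds are counts of cells. For the Poincaré inequality let `F p` be the
value of `f` at a vertex chosen in the cell `p`, and let `A p` be the average of `F` over the box of
radius `N` around `p`, where `N` is a small fraction of `n`. Then `f - F` is bounded on the ball by
a multiple of the root of the energy, `F - A` is small in square mean because `F` differs from its
translates by at most their length times the gradient (`sum_sq_translate_sub_le`), and by the same
estimate `A` changes by at most a multiple of the root of the energy over a distance `N`, while
boundedly many steps of length `N` lead to the center. As `N` is small, only the energy in the ball
of radius `2 n` enters (`IsLatticeLike.poincare_of_large`).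
-/

/-! ### The drawing and its faces -/

section Geometry

open Set Metric MeasureTheory

theorem volume_segment_complex (a b : ℂ) : volume (segment ℝ a b) = 0 := by
  have hsub : segment ℝ a b ⊆ (affineSpan ℝ {a, b} : AffineSubspace ℝ ℂ) := by
    rw [← convexHull_pair]
    exact convexHull_subset_affineSpan _
  refine measure_mono_null hsub (Measure.addHaar_affineSubspace _ _ fun htop => ?_)
  have h1 := (collinear_iff_finrank_le_one (k := ℝ)).1 (collinear_pair ℝ a b)
  rw [← direction_affineSpan, htop, AffineSubspace.direction_top, finrank_top,
    Complex.finrank_real_complex] at h1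
  omega

namespace PlaneGraph

variable {Γ : PlaneGraph} {h : ℝ}

theorem segment_subset_skeleton {u v : Γ.V} (huv : Γ.graph.Adj u v) :
    segment ℝ (u : ℂ) v ⊆ Γ.skeleton := fun _ hz => Or.inr ⟨u, v, huv, hz⟩

theorem exists_adj_of_mem_skeleton {z : ℂ} (hz : z ∈ Γ.skeleton) (hzV : z ∉ Γ.V) :
    ∃ u v : Γ.V, Γ.graph.Adj u v ∧ z ∈ openSegment ℝ (u : ℂ) v := by
  rcases hz with hz | ⟨u, v, huv, hz⟩
  · exact absurd hz hzV
  · refine ⟨u, v, huv, mem_openSegment_of_ne_left_right ?_ ?_ hz⟩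
    · rintro rfl
      exact hzV u.2
    · rintro rfl
      exact hzV v.2

theorem skeleton_inter_eq (K : Set ℂ) : Γ.skeleton ∩ K = (Γ.V ∩ K) ∪
    (⋃ p ∈ {p : Γ.V × Γ.V | Γ.graph.Adj p.1 p.2 ∧ (segment ℝ (p.1 : ℂ) p.2 ∩ K).Nonempty},
      segment ℝ (p.1 : ℂ) p.2) ∩ K := by
  ext z
  constructor
  · rintro ⟨hz | ⟨u, v, huv, hz⟩, hK⟩
    · exact Or.inl ⟨hz, hK⟩
    · exact Or.inr ⟨mem_biUnion (x := (u, v)) ⟨huv, ⟨z, hz, hK⟩⟩ hz, hK⟩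
  · rintro (⟨hz, hK⟩ | ⟨hz, hK⟩)
    · exact ⟨Or.inl hz, hK⟩
    · simp only [mem_iUnion] at hz
      obtain ⟨p, hp, hz⟩ := hz
      exact ⟨Or.inr ⟨p.1, p.2, hp.1, hz⟩, hK⟩

theorem isClosed_segment_complex (a b : ℂ) : IsClosed (segment ℝ a b) := by
  rw [← convexHull_pair]
  exact ((Set.toFinite {a, b}).isCompact_convexHull ℝ).isClosed

theorem isClosed_skeleton : IsClosed Γ.skeleton := by
  refine isClosed_of_closure_subset fun z hz => ?_
  have hK : IsClosed (Γ.skeleton ∩ closedBall z 1) := by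
    rw [skeleton_inter_eq]
    exact (Γ.finite_vertices _ (isCompact_closedBall z 1)).isClosed.union
      (((Γ.finite_edges _ (isCompact_closedBall z 1)).isClosed_biUnion
        fun p _ => isClosed_segment_complex _ _).inter isClosed_closedBall)
  have h1 := isOpen_ball.inter_closure ⟨mem_ball_self (x := z) one_pos, hz⟩
  have h2 : Metric.ball z 1 ∩ Γ.skeleton ⊆ Γ.skeleton ∩ closedBall z 1 :=
    fun x hx => ⟨hx.2, ball_subset_closedBall hx.1⟩
  exact (closure_minimal h2 hK h1).1

/-- The drawing is a locally finite union of points and segments, hence nowhere dense. -/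
theorem dense_compl_skeleton : Dense (Γ.skeletonᶜ) := by
  rw [← interior_eq_empty_iff_dense_compl, Set.eq_empty_iff_forall_notMem]
  intro z hz
  have hnull : volume (Γ.skeleton ∩ closedBall z 1) = 0 := by
    rw [skeleton_inter_eq]
    refine measure_union_null
      ((Γ.finite_vertices _ (isCompact_closedBall z 1)).measure_zero _)
      (measure_mono_null inter_subset_left ?_)
    exact (measure_biUnion_null_iff (Γ.finite_edges _ (isCompact_closedBall z 1)).countable).2
      fun p _ => volume_segment_complex _ _
  have h1 := Measure.interior_eq_empty_of_null hnull
  rw [interior_inter] at h1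
  exact (Set.eq_empty_iff_forall_notMem.1 h1) z
    ⟨hz, ball_subset_interior_closedBall (mem_ball_self one_pos)⟩

theorem isOpen_of_mem_faces {f : Set ℂ} (hf : f ∈ Γ.faces) : IsOpen f := by
  obtain ⟨z, -, rfl⟩ := hf
  exact isClosed_skeleton.isOpen_compl.connectedComponentIn

theorem disjoint_skeleton_of_mem_faces {f : Set ℂ} (hf : f ∈ Γ.faces) {z : ℂ} (hz : z ∈ f) :
    z ∉ Γ.skeleton := by
  obtain ⟨w, -, rfl⟩ := hf
  exact connectedComponentIn_subset _ _ hz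

theorem faces_eq_of_mem {f g : Set ℂ} (hf : f ∈ Γ.faces) (hg : g ∈ Γ.faces) {z : ℂ} (hzf : z ∈ f)
    (hzg : z ∈ g) : f = g := by
  obtain ⟨w, -, rfl⟩ := hf
  obtain ⟨w', -, rfl⟩ := hg
  rw [connectedComponentIn_eq hzf, connectedComponentIn_eq hzg]

theorem exists_face_of_notMem_skeleton {z : ℂ} (hz : z ∉ Γ.skeleton) : ∃ f ∈ Γ.faces, z ∈ f :=
  ⟨_, ⟨z, hz, rfl⟩, mem_connectedComponentIn hz⟩

theorem frontier_subset_skeleton {f : Set ℂ} (hf : f ∈ Γ.faces) : frontier f ⊆ Γ.skeleton := by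
  intro z hz
  by_contra hzs
  obtain ⟨g, hg, hzg⟩ := exists_face_of_notMem_skeleton hzs
  obtain ⟨x, hxg, hxf⟩ := mem_closure_iff.1 hz.1 g (isOpen_of_mem_faces hg) hzg
  rw [faces_eq_of_mem hg hf hxg hxf] at hzg
  exact hz.2 (by rwa [(isOpen_of_mem_faces hf).interior_eq])

theorem mem_frontier_of_mem_closure {f : Set ℂ} (hf : f ∈ Γ.faces) {z : ℂ} (hz : z ∈ closure f)
    (hzs : z ∈ Γ.skeleton) : z ∈ frontier f :=
  ⟨hz, fun hzi => disjoint_skeleton_of_mem_faces hf (interior_subset hzi) hzs⟩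

theorem mem_corners_of_mem_closure {f : Set ℂ} (hf : f ∈ Γ.faces) {v : ℂ} (hv : v ∈ Γ.V)
    (hvf : v ∈ closure f) : v ∈ Γ.corners f :=
  ⟨hv, mem_frontier_of_mem_closure hf hvf (Or.inl hv)⟩

/-! ### A single isoradial face -/

namespace IsoradialFace

variable {f : Set ℂ}

theorem finite_corners (H : Γ.IsoradialFace h f) : (Γ.corners f).Finite := by
  obtain ⟨c, -, hc⟩ := H.2
  refine (Γ.finite_vertices _ (isCompact_closedBall c (h / 2))).subset fun v hv => ⟨hv.1, ?_⟩
  exact (hc v hv).le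

theorem convex (H : Γ.IsoradialFace h f) : Convex ℝ f := by
  rw [H.1]
  exact (convex_convexHull ℝ _).interior

theorem isOpen (H : Γ.IsoradialFace h f) : IsOpen f := by
  rw [H.1]
  exact isOpen_interior

theorem closure_eq (H : Γ.IsoradialFace h f) : closure f = convexHull ℝ (Γ.corners f) := by
  refine subset_antisymm ?_ ?_
  · refine closure_minimal ?_ (H.finite_corners.isCompact_convexHull ℝ).isClosed
    conv_lhs => rw [H.1]
    exact interior_subset
  · exact convexHull_min (fun v hv => frontier_subset_closure hv.2) H.convex.closure

theorem closure_subset_closedBall (H : Γ.IsoradialFace h f) {c : ℂ}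
    (hc : ∀ v ∈ Γ.corners f, dist v c = h / 2) : closure f ⊆ closedBall c (h / 2) := by
  rw [H.closure_eq]
  exact convexHull_min (fun v hv => (hc v hv).le) (convex_closedBall _ _)

theorem dist_le (H : Γ.IsoradialFace h f) {x y : ℂ} (hx : x ∈ closure f) (hy : y ∈ closure f) :
    dist x y ≤ h := by
  obtain ⟨c, -, hc⟩ := H.2
  have h1 := H.closure_subset_closedBall hc hx
  have h2 := H.closure_subset_closedBall hc hy
  rw [mem_closedBall] at h1 h2
  linarith [dist_triangle_right x y c]

/-- The corners do not lie on a segment, since their convex hull has interior points. -/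
theorem exists_corner_ne (H : Γ.IsoradialFace h f) (v w : ℂ) :
    ∃ p ∈ Γ.corners f, p ≠ v ∧ p ≠ w := by
  by_contra! hcon
  obtain ⟨c, hcf, -⟩ := H.2
  have hsub : Γ.corners f ⊆ segment ℝ v w := by
    intro p hp
    by_cases hpv : p = v
    · exact hpv ▸ left_mem_segment ℝ v w
    · exact hcon p hp hpv ▸ right_mem_segment ℝ v w
  rw [H.1] at hcf
  have h1 := interior_mono (convexHull_min hsub (convex_segment v w)) hcf
  rwa [Measure.interior_eq_empty_of_null (volume_segment_complex v w)] at h1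

end IsoradialFace

/-- Isoradial faces are locally finite, because a face is determined by its corners; hence every
point of the plane is in the closure of a face. -/
theorem IsIsoradial.exists_mem_closure_face (H : Γ.IsIsoradial h) (z : ℂ) :
    ∃ f ∈ Γ.faces, z ∈ closure f := by
  have hfin : {f | f ∈ Γ.faces ∧ (Metric.ball z 1 ∩ f).Nonempty}.Finite := by
    have hV := (Γ.finite_vertices _ (isCompact_closedBall z (1 + h))).finite_subsets
    refine Set.Finite.of_finite_image (f := Γ.corners) (hV.subset ?_) ?_
    · rintro _ ⟨f, ⟨hf, x, hxb, hxf⟩, rfl⟩ v hv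
      refine ⟨hv.1, ?_⟩
      have h1 := (H f hf).dist_le (frontier_subset_closure hv.2) (subset_closure hxf)
      rw [mem_ball] at hxb
      rw [mem_closedBall]
      linarith [dist_triangle v x z]
    · rintro f ⟨hf, -⟩ g ⟨hg, -⟩ hfg
      rw [(H f hf).1, (H g hg).1, hfg]
  have h1 : z ∈ closure (Metric.ball z 1 ∩ Γ.skeletonᶜ) :=
    isOpen_ball.inter_closure ⟨mem_ball_self one_pos, dense_compl_skeleton z⟩
  have h2 : Metric.ball z 1 ∩ Γ.skeletonᶜ ⊆
      ⋃ f ∈ {f | f ∈ Γ.faces ∧ (Metric.ball z 1 ∩ f).Nonempty}, f := by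
    rintro x ⟨hxb, hxs⟩
    obtain ⟨f, hf, hxf⟩ := exists_face_of_notMem_skeleton hxs
    exact mem_biUnion (show f ∈ {f | f ∈ Γ.faces ∧ (Metric.ball z 1 ∩ f).Nonempty} from
      ⟨hf, x, hxb, hxf⟩) hxf
  have h3 := closure_mono h2 h1
  rw [hfin.closure_biUnion] at h3
  simp only [mem_iUnion] at h3
  obtain ⟨f, hf, hz⟩ := h3
  exact ⟨f, hf.1, hz⟩

end PlaneGraph

/-! ### Sides of convex sets in the plane -/

theorem ContinuousLinearMap.complex_apply_eq (g : ℂ →L[ℝ] ℝ) (x : ℂ) :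
    g x = g 1 * x.re + g Complex.I * x.im := by
  conv_lhs => rw [← Complex.re_add_im x]
  have h1 : ((x.re : ℂ) + x.im * Complex.I) = x.re • (1 : ℂ) + x.im • Complex.I := by
    simp
  rw [h1, map_add, map_smul, map_smul, smul_eq_mul, smul_eq_mul]
  ring

/-- The kernel of a nonzero real functional on `ℂ` is at most one-dimensional. -/
theorem ContinuousLinearMap.exists_eq_smul_of_apply_eq_zero {g : ℂ →L[ℝ] ℝ} {x k d : ℂ}
    (hx : g x ≠ 0) (hk : g k = 0) (hd : g d = 0) (hd0 : d ≠ 0) : ∃ t : ℝ, k = t • d := by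
  rw [g.complex_apply_eq] at hx hk hd
  set p := g 1
  set q := g Complex.I
  have hdet : k.re * d.im = k.im * d.re := by
    by_cases hp : p = 0
    · have hq : q ≠ 0 := by
        rintro hq
        simp [hp, hq] at hx
      have h1 : k.im = 0 := by simpa [hp, hq] using hk
      have h2 : d.im = 0 := by simpa [hp, hq] using hd
      simp [h1, h2]
    · apply mul_left_cancel₀ hp
      linear_combination d.im * hk - k.im * hd
  have hn : d.re ^ 2 + d.im ^ 2 ≠ 0 := by
    intro h0
    apply hd0
    have h1 : d.re = 0 := by nlinarith [sq_nonneg d.re, sq_nonneg d.im]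
    have h2 : d.im = 0 := by nlinarith [sq_nonneg d.re, sq_nonneg d.im]
    exact Complex.ext h1 h2
  refine ⟨(k.re * d.re + k.im * d.im) / (d.re ^ 2 + d.im ^ 2), Complex.ext ?_ ?_⟩
  · rw [Complex.smul_re, smul_eq_mul, div_mul_eq_mul_div, eq_div_iff hn]
    linear_combination d.im * hdet
  · rw [Complex.smul_im, smul_eq_mul, div_mul_eq_mul_div, eq_div_iff hn]
    linear_combination -d.re * hdet

/-- If `z` lies inside a side `[v, w]` of an open convex planar set `f`, then a segment that starts
at `z` and avoids `f` cannot enter the half-plane containing `f`: near `z` that half-plane is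
filled by `f`. -/
theorem Convex.le_of_segment_disjoint_side {f : Set ℂ} (hconv : Convex ℝ f) (hopen : IsOpen f)
    {c v w z a : ℂ} (hc : c ∈ f) (hv : v ∈ closure f) (hw : w ∈ closure f) (hvw : v ≠ w)
    (hz : z ∈ openSegment ℝ v w) {g : ℂ →L[ℝ] ℝ} (hg : ∀ x ∈ f, g x < g z) (hgv : g v = g z)
    (hgw : g w = g z) (ha : ∀ y ∈ segment ℝ z a, y ∉ f) : g z ≤ g a := by
  by_contra! hlt
  have hgc := hg c hc
  rw [openSegment_eq_image'] at hz
  obtain ⟨θ, ⟨hθ0, hθ1⟩, hzθ⟩ := hz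
  have hzθ : v + θ • (w - v) = z := hzθ
  obtain ⟨t, ht⟩ : ∃ t : ℝ, a - z - ((g z - g a) / (g z - g c)) • (c - z) = t • (w - v) := by
    refine ContinuousLinearMap.exists_eq_smul_of_apply_eq_zero (g := g) (x := c - z) ?_ ?_ ?_ ?_
    · rw [map_sub]; linarith
    · have : g z - g c ≠ 0 := by linarith
      simp only [map_sub, map_smul, smul_eq_mul]
      field_simp
      ring
    · rw [map_sub]; linarith
    · exact sub_ne_zero.2 hvw.symm
  set s := (g z - g a) / (g z - g c) with hs
  have hs0 : 0 < s := div_pos (by linarith) (by linarith)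
  -- for small `ε` the point `z + ε (a - z)` is a convex combination of `c` and a point of `[v, w]`
  have hcont : ContinuousAt (fun ε : ℝ => θ + ε * t / (1 - ε * s)) 0 := by
    apply ContinuousAt.add continuousAt_const
    exact ContinuousAt.div (by fun_prop) (by fun_prop) (by simp)
  have hev1 : ∀ᶠ ε in nhds (0 : ℝ), θ + ε * t / (1 - ε * s) ∈ Ioo (0 : ℝ) 1 := by
    apply hcont.eventually_mem
    simpa using Ioo_mem_nhds hθ0 hθ1
  have hev2 : ∀ᶠ ε in nhds (0 : ℝ), ε * s < 1 := by
    have : ContinuousAt (fun ε : ℝ => ε * s) 0 := by fun_prop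
    apply this.eventually_lt continuousAt_const
    simp
  have hev3 : ∀ᶠ ε in nhds (0 : ℝ), ε < 1 := eventually_lt_nhds one_pos
  have hev := ((hev1.and (hev2.and hev3)).filter_mono nhdsWithin_le_nhds).and
    (self_mem_nhdsWithin (s := Ioi (0 : ℝ)))
  obtain ⟨ε, ⟨⟨hq0, hq1⟩, hεs, hε1⟩, hε0⟩ := hev.exists
  have hε0 : 0 < ε := hε0
  set q := θ + ε * t / (1 - ε * s) with hq
  have hy : z + ε • (a - z) ∈ segment ℝ z a := by
    rw [segment_eq_image']
    exact ⟨ε, ⟨hε0.le, hε1.le⟩, rfl⟩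
  refine ha _ hy ?_
  have hqcl : v + q • (w - v) ∈ closure f := by
    refine hconv.closure.segment_subset hv hw ?_
    rw [segment_eq_image']
    exact ⟨q, ⟨hq0.le, hq1.le⟩, rfl⟩
  rw [← hopen.interior_eq] at hc
  have hin := hconv.openSegment_interior_closure_subset_interior hc hqcl
  rw [hopen.interior_eq] at hin
  refine hin ⟨ε * s, 1 - ε * s, by positivity, by linarith, by ring, ?_⟩
  have hne : 1 - ε * s ≠ 0 := by linarith
  have hqe : (1 - ε * s) * q = (1 - ε * s) * θ + ε * t := by
    rw [hq]
    field_simp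
  have haz : a - z = s • (c - z) + t • (w - v) := by rw [← ht]; abel
  rw [haz, smul_add (1 - ε * s), smul_smul (1 - ε * s) q, hqe, ← hzθ]
  module

/-- Two segments on a common line, crossing in their interiors, the endpoints of the first not
being inside the second: then the second is contained in the first. -/
theorem mem_segment_of_mem_openSegment {g : ℂ →L[ℝ] ℝ} {x v w a b z : ℂ} (hx : g x ≠ g z)
    (hvw : v ≠ w) (hz : z ∈ openSegment ℝ v w) (hz' : z ∈ openSegment ℝ a b) (hgv : g v = g z)
    (hgw : g w = g z) (hga : g a = g z) (hgb : g b = g z) (hv : v ∉ openSegment ℝ a b)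
    (hw : w ∉ openSegment ℝ a b) : a ∈ segment ℝ v w ∧ b ∈ segment ℝ v w := by
  have key : ∀ y, g y = g z → ∃ t : ℝ, y = v + t • (w - v) := by
    intro y hy
    obtain ⟨t, ht⟩ := ContinuousLinearMap.exists_eq_smul_of_apply_eq_zero (g := g) (x := x - z)
      (k := y - v) (d := w - v) (by rw [map_sub]; exact sub_ne_zero.2 hx)
      (by rw [map_sub]; linarith) (by rw [map_sub]; linarith) (sub_ne_zero.2 hvw.symm)
    exact ⟨t, by rw [← ht]; abel⟩
  obtain ⟨α, hα⟩ := key a hga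
  obtain ⟨β, hβ⟩ := key b hgb
  have hd : w - v ≠ 0 := sub_ne_zero.2 hvw.symm
  have hopen : ∀ t : ℝ, 0 < t → t < 1 → v + (α + t * (β - α)) • (w - v) ∈ openSegment ℝ a b := by
    intro t h0 h1
    rw [openSegment_eq_image']
    refine ⟨t, ⟨h0, h1⟩, ?_⟩
    simp only [hα, hβ]
    module
  rw [openSegment_eq_image'] at hz hz'
  obtain ⟨θ, ⟨hθ0, hθ1⟩, hzθ⟩ := hz
  obtain ⟨τ, ⟨hτ0, hτ1⟩, hzτ⟩ := hz'
  have hθ : θ = α + τ * (β - α) := by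
    have h1 : (θ - (α + τ * (β - α))) • (w - v) = 0 := by
      simp only [hα, hβ] at hzτ
      have h2 := hzθ.trans hzτ.symm
      simp only at h2
      rw [← sub_eq_zero] at h2
      rw [← h2]
      module
    rcases smul_eq_zero.1 h1 with h2 | h2
    · linarith
    · exact absurd h2 hd
  have hno : ∀ s : ℝ, v + s • (w - v) ∉ openSegment ℝ a b → ∀ t : ℝ, 0 < t → t < 1 →
      s ≠ α + t * (β - α) := by
    rintro s hs t h0 h1 rfl
    exact hs (hopen t h0 h1)
  have hn0 := hno 0 (by simpa using hv)
  have hn1 := hno 1 (by simpa using hw)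
  have hrange : ∀ s : ℝ, (∀ t : ℝ, 0 < t → t < 1 → s ≠ α + t * (β - α)) →
      ¬ (α < s ∧ s < β) ∧ ¬ (β < s ∧ s < α) := by
    intro s hs
    constructor
    · rintro ⟨h1, h2⟩
      refine hs ((s - α) / (β - α)) (div_pos (by linarith) (by linarith))
        ((div_lt_one (by linarith)).2 (by linarith)) ?_
      rw [div_mul_cancel₀ _ (by linarith)]
      ring
    · rintro ⟨h1, h2⟩
      refine hs ((α - s) / (α - β)) (div_pos (by linarith) (by linarith))
        ((div_lt_one (by linarith)).2 (by linarith)) ?_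
      have : α - β ≠ 0 := by linarith
      field_simp
      ring
  obtain ⟨h01, h02⟩ := hrange 0 hn0
  obtain ⟨h11, h12⟩ := hrange 1 hn1
  have hbounds : (0 ≤ α ∧ α ≤ 1) ∧ (0 ≤ β ∧ β ≤ 1) := by
    rcases lt_trichotomy α β with hlt | heq | hgt
    · have h3 : α < θ := by nlinarith
      have h4 : θ < β := by nlinarith
      have h5 : 0 ≤ α := by
        by_contra! h6
        exact h01 ⟨h6, by linarith⟩
      have h7 : β ≤ 1 := by
        by_contra! h6
        exact h11 ⟨by linarith, h6⟩
      exact ⟨⟨h5, by linarith⟩, by linarith, h7⟩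
    · subst heq
      have h3 : θ = α := by rw [hθ]; ring
      exact ⟨⟨by linarith, by linarith⟩, by linarith, by linarith⟩
    · have h3 : θ < α := by nlinarith
      have h4 : β < θ := by nlinarith
      have h5 : 0 ≤ β := by
        by_contra! h6
        exact h02 ⟨h6, by linarith⟩
      have h7 : α ≤ 1 := by
        by_contra! h6
        exact h12 ⟨by linarith, h6⟩
      exact ⟨⟨by linarith, h7⟩, h5, by linarith⟩
  rw [segment_eq_image']
  exact ⟨⟨α, hbounds.1, hα.symm⟩, ⟨β, hbounds.2, hβ.symm⟩⟩

/-! ### Edges along the boundary of a face -/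

namespace PlaneGraph

variable {Γ : PlaneGraph} {h : ℝ} {f : Set ℂ}

/-- A boundary point of a face that is not a vertex lies inside a segment between two corners
on a supporting line of the face. -/
theorem IsoradialFace.exists_side (H : Γ.IsoradialFace h f) {z : ℂ} (hz : z ∈ frontier f)
    (hzV : z ∉ Γ.V) : ∃ v ∈ Γ.corners f, ∃ w ∈ Γ.corners f, z ∈ openSegment ℝ v w ∧
      ∃ g : ℂ →L[ℝ] ℝ, (∀ x ∈ f, g x < g z) ∧ g v = g z ∧ g w = g z := by
  have hzf : z ∉ f := fun hzf => hz.2 (by rwa [H.isOpen.interior_eq])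
  obtain ⟨g, hg⟩ := geometric_hahn_banach_open_point H.convex H.isOpen hzf
  obtain ⟨c, hcf, -⟩ := H.2
  have hgcl : ∀ x ∈ closure f, g x ≤ g z := fun x hx =>
    closure_minimal (fun y hy => (hg y hy).le) (isClosed_le g.continuous continuous_const) hx
  have hzc : z ∈ convexHull ℝ (Γ.corners f) := H.closure_eq ▸ hz.1
  obtain ⟨ι, _, p, μ, hp, -, hpos, hsum, hcomb⟩ := eq_pos_convex_span_of_mem_convexHull hzc
  have hpc : ∀ i, p i ∈ Γ.corners f := fun i => hp (mem_range_self i)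
  have hgp : ∀ i, g (p i) = g z := by
    have h1 : ∑ i, μ i * (g z - g (p i)) = 0 := by
      simp only [mul_sub, Finset.sum_sub_distrib, ← Finset.sum_mul, hsum, one_mul]
      rw [← hcomb, map_sum, sub_eq_zero]
      exact Finset.sum_congr rfl fun i _ => by rw [map_smul, smul_eq_mul]
    have h2 := (Finset.sum_eq_zero_iff_of_nonneg fun i _ => mul_nonneg (hpos i).le
      (sub_nonneg.2 (hgcl _ (frontier_subset_closure (hpc i).2)))).1 h1
    intro i
    have h3 := (mul_eq_zero.1 (h2 i (Finset.mem_univ i))).resolve_left (hpos i).ne'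
    linarith
  have hgne : g (c - z) ≠ 0 := by
    rw [map_sub]
    linarith [hg c hcf]
  -- `d` spans the kernel of `g`
  obtain ⟨d, hd0, hd⟩ : ∃ d : ℂ, d ≠ 0 ∧ g d = 0 := by
    refine ⟨⟨-g Complex.I, g 1⟩, fun h0 => hgne ?_, ?_⟩
    · have h1 := congrArg Complex.re h0
      have h2 := congrArg Complex.im h0
      simp only [Complex.zero_re, Complex.zero_im, neg_eq_zero] at h1 h2
      rw [g.complex_apply_eq, h1, h2]
      ring
    · rw [g.complex_apply_eq]
      ring
  have hk : ∀ i, ∃ t : ℝ, p i - z = t • d := fun i =>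
    ContinuousLinearMap.exists_eq_smul_of_apply_eq_zero hgne (by rw [map_sub, hgp, sub_self]) hd hd0
  choose k hk using hk
  have hk0 : ∀ i, k i ≠ 0 := by
    intro i h0
    have h1 := hk i
    rw [h0, zero_smul, sub_eq_zero] at h1
    exact hzV (h1 ▸ (hpc i).1)
  have hksum : ∑ i, μ i * k i = 0 := by
    have h1 : (∑ i, μ i * k i) • d = 0 := by
      rw [Finset.sum_smul]
      simp only [mul_smul, ← hk, smul_sub, Finset.sum_sub_distrib, hcomb, ← Finset.sum_smul, hsum,
        one_smul, sub_self]
    exact (smul_eq_zero.1 h1).resolve_right hd0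
  obtain ⟨i₀⟩ : Nonempty ι := by
    by_contra hemp
    rw [not_nonempty_iff] at hemp
    simp at hsum
  obtain ⟨i, hi⟩ : ∃ i, k i < 0 := by
    by_contra! hcon
    have := (Finset.sum_eq_zero_iff_of_nonneg fun i _ => mul_nonneg (hpos i).le (hcon i)).1 hksum
      i₀ (Finset.mem_univ _)
    exact (mul_ne_zero (hpos i₀).ne' (hk0 i₀)) this
  obtain ⟨j, hj⟩ : ∃ j, 0 < k j := by
    by_contra! hcon
    have := (Finset.sum_eq_zero_iff_of_nonpos fun i _ =>
      mul_nonpos_of_nonneg_of_nonpos (hpos i).le (hcon i)).1 hksum i₀ (Finset.mem_univ _)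
    exact (mul_ne_zero (hpos i₀).ne' (hk0 i₀)) this
  refine ⟨p i, hpc i, p j, hpc j, ?_, g, hg, hgp i, hgp j⟩
  have hne : k j - k i ≠ 0 := by linarith
  refine ⟨k j / (k j - k i), -k i / (k j - k i), div_pos hj (by linarith),
    div_pos (by linarith) (by linarith), by field_simp; ring, ?_⟩
  have h1 : p i = z + k i • d := by rw [← hk]; abel
  have h2 : p j = z + k j • d := by rw [← hk]; abel
  have h3 : k j / (k j - k i) + -k i / (k j - k i) = 1 := by field_simp; ring
  have h4 : k j / (k j - k i) * k i + -k i / (k j - k i) * k j = 0 := by field_simp; ring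
  rw [h1, h2]
  calc _ = (k j / (k j - k i) + -k i / (k j - k i)) • z +
        (k j / (k j - k i) * k i + -k i / (k j - k i) * k j) • d := by module
    _ = z := by rw [h3, h4]; simp

/-- An edge that passes through an inner point of a side of a face is contained in that side. -/
theorem edge_subset_side (hf : f ∈ Γ.faces) (H : Γ.IsoradialFace h f) {v w z : ℂ}
    (hv : v ∈ Γ.corners f) (hw : w ∈ Γ.corners f) (hvw : v ≠ w) (hz : z ∈ openSegment ℝ v w)
    {g : ℂ →L[ℝ] ℝ} (hg : ∀ x ∈ f, g x < g z) (hgv : g v = g z) (hgw : g w = g z) {a b : Γ.V}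
    (hab : Γ.graph.Adj a b) (hz' : z ∈ openSegment ℝ (a : ℂ) b) :
    (a : ℂ) ∈ segment ℝ v w ∧ (b : ℂ) ∈ segment ℝ v w := by
  obtain ⟨c, hcf, -⟩ := H.2
  have key : ∀ y ∈ segment ℝ (a : ℂ) b, g z ≤ g y := by
    intro y hy
    refine H.convex.le_of_segment_disjoint_side H.isOpen hcf (frontier_subset_closure hv.2)
      (frontier_subset_closure hw.2) hvw hz hg hgv hgw fun x hx hxf => ?_
    refine disjoint_skeleton_of_mem_faces hf hxf (segment_subset_skeleton hab ?_)
    exact (convex_segment _ _).segment_subset (openSegment_subset_segment _ _ _ hz') hy hx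
  have ha := key _ (left_mem_segment ℝ _ _)
  have hb := key _ (right_mem_segment ℝ _ _)
  have hgab : g a = g z ∧ g b = g z := by
    obtain ⟨s, t, hs, ht, hst, hzst⟩ := hz'
    have h1 : s * g a + t * g b = g z := by
      rw [← hzst, map_add, map_smul, map_smul, smul_eq_mul, smul_eq_mul]
    have h2 : s * (g a - g z) + t * (g b - g z) = 0 := by
      linear_combination h1 - g z * hst
    constructor
    · nlinarith [mul_nonneg ht.le (sub_nonneg.2 hb)]
    · nlinarith [mul_nonneg hs.le (sub_nonneg.2 ha)]
  exact mem_segment_of_mem_openSegment (hg c hcf).ne hvw hz hz' hgv hgw hgab.1 hgab.2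
    (Γ.vertex_notMem_edge a b ⟨v, hv.1⟩ hab) (Γ.vertex_notMem_edge a b ⟨w, hw.1⟩ hab)

/-- An edge with an inner point on the boundary of a face has both endpoints as corners. -/
theorem mem_corners_of_mem_openSegment (hf : f ∈ Γ.faces) (H : Γ.IsoradialFace h f) {z : ℂ}
    (hz : z ∈ frontier f) {a b : Γ.V} (hab : Γ.graph.Adj a b)
    (hz' : z ∈ openSegment ℝ (a : ℂ) b) : (a : ℂ) ∈ Γ.corners f ∧ (b : ℂ) ∈ Γ.corners f := by
  have hzV : z ∉ Γ.V := fun hzV => Γ.vertex_notMem_edge a b ⟨z, hzV⟩ hab hz'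
  obtain ⟨v, hv, w, hw, hzvw, g, hg, hgv, hgw⟩ := H.exists_side hz hzV
  have hvw : v ≠ w := by
    rintro rfl
    rw [openSegment_same] at hzvw
    exact hzV (hzvw ▸ hv.1)
  have hsub : segment ℝ v w ⊆ closure f := H.convex.closure.segment_subset
    (frontier_subset_closure hv.2) (frontier_subset_closure hw.2)
  have h1 := edge_subset_side hf H hv hw hvw hzvw hg hgv hgw hab hz'
  exact ⟨mem_corners_of_mem_closure hf a.2 (hsub h1.1),
    mem_corners_of_mem_closure hf b.2 (hsub h1.2)⟩

theorem IsIsoradial.dist_le_of_adj (H : Γ.IsIsoradial h) {a b : Γ.V} (hab : Γ.graph.Adj a b) :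
    dist (a : ℂ) b ≤ h := by
  have hne : (a : ℂ) ≠ b := fun h0 => hab.ne (Subtype.ext h0)
  obtain ⟨z, hz⟩ : (openSegment ℝ (a : ℂ) b).Nonempty :=
    ⟨_, 1 / 2, 1 / 2, by norm_num, by norm_num, by norm_num, rfl⟩
  obtain ⟨f, hf, hzf⟩ := H.exists_mem_closure_face z
  have hzfr := mem_frontier_of_mem_closure hf hzf
    (segment_subset_skeleton hab (openSegment_subset_segment _ _ _ hz))
  obtain ⟨ha, hb⟩ := mem_corners_of_mem_openSegment hf (H f hf) hzfr hab hz
  exact (H f hf).dist_le (frontier_subset_closure ha.2) (frontier_subset_closure hb.2)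

/-- Two faces whose closures meet have a common corner. -/
theorem IsIsoradial.exists_common_corner (H : Γ.IsIsoradial h) {f g : Set ℂ} (hf : f ∈ Γ.faces)
    (hg : g ∈ Γ.faces) {z : ℂ} (hzf : z ∈ closure f) (hzg : z ∈ closure g) (hfg : f ≠ g) :
    ∃ v, v ∈ Γ.corners f ∧ v ∈ Γ.corners g := by
  have hzs : z ∈ Γ.skeleton := by
    by_contra hzs
    obtain ⟨k, hk, hzk⟩ := exists_face_of_notMem_skeleton hzs
    obtain ⟨x, hx, hx'⟩ := mem_closure_iff.1 hzf k (isOpen_of_mem_faces hk) hzk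
    obtain ⟨y, hy, hy'⟩ := mem_closure_iff.1 hzg k (isOpen_of_mem_faces hk) hzk
    exact hfg ((faces_eq_of_mem hf hk hx' hx).trans (faces_eq_of_mem hk hg hy hy'))
  by_cases hzV : z ∈ Γ.V
  · exact ⟨z, mem_corners_of_mem_closure hf hzV hzf, mem_corners_of_mem_closure hg hzV hzg⟩
  · obtain ⟨a, b, hab, hz⟩ := exists_adj_of_mem_skeleton hzs hzV
    exact ⟨a, (mem_corners_of_mem_openSegment hf (H f hf)
      (mem_frontier_of_mem_closure hf hzf hzs) hab hz).1,
      (mem_corners_of_mem_openSegment hg (H g hg)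
      (mem_frontier_of_mem_closure hg hzg hzs) hab hz).1⟩

end PlaneGraph

/-! ### Chords of a circle -/

theorem Complex.dist_sq_eq (x y : ℂ) :
    dist x y ^ 2 = (x.re - y.re) ^ 2 + (x.im - y.im) ^ 2 := by
  rw [Complex.dist_eq, Complex.sq_norm, Complex.normSq_apply, Complex.sub_re, Complex.sub_im]
  ring

/-- On a circle, a point `p` beyond the chord from `v` to `w` (as seen from the center) is closer
to both `v` and `w` than these are to each other.  In coordinates with the center at the origin
`m` is the midpoint of the chord and `m - d`, `m + d` are its endpoints. -/
theorem inner_lt_of_beyond_chord {m₁ m₂ d₁ d₂ p₁ p₂ : ℝ} (horth : m₁ * d₁ + m₂ * d₂ = 0)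
    (hd : 0 < d₁ ^ 2 + d₂ ^ 2) (hm : 0 < m₁ ^ 2 + m₂ ^ 2)
    (hp : p₁ ^ 2 + p₂ ^ 2 = m₁ ^ 2 + m₂ ^ 2 + (d₁ ^ 2 + d₂ ^ 2))
    (hfar : m₁ ^ 2 + m₂ ^ 2 < m₁ * p₁ + m₂ * p₂) :
    |d₁ * p₁ + d₂ * p₂| < d₁ ^ 2 + d₂ ^ 2 := by
  have hgram : (m₁ * p₁ + m₂ * p₂) ^ 2 * (d₁ ^ 2 + d₂ ^ 2) +
      (d₁ * p₁ + d₂ * p₂) ^ 2 * (m₁ ^ 2 + m₂ ^ 2) =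
      (p₁ ^ 2 + p₂ ^ 2) * (m₁ ^ 2 + m₂ ^ 2) * (d₁ ^ 2 + d₂ ^ 2) := by
    linear_combination (2 * (m₁ * p₁ + m₂ * p₂) * (d₁ * p₁ + d₂ * p₂) -
      (p₁ ^ 2 + p₂ ^ 2) * (m₁ * d₁ + m₂ * d₂)) * horth
  rw [hp] at hgram
  have h1 : (m₁ ^ 2 + m₂ ^ 2) ^ 2 < (m₁ * p₁ + m₂ * p₂) ^ 2 := by
    gcongr
  have h2 : (m₁ ^ 2 + m₂ ^ 2) ^ 2 * (d₁ ^ 2 + d₂ ^ 2) <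
      (m₁ * p₁ + m₂ * p₂) ^ 2 * (d₁ ^ 2 + d₂ ^ 2) := by
    gcongr
  refine abs_lt_of_sq_lt_sq ?_ hd.le
  refine lt_of_mul_lt_mul_right ?_ hm.le
  linarith

theorem dist_lt_of_beyond_chord {c v w p : ℂ} {r : ℝ} (hv : dist v c = r) (hw : dist w c = r)
    (hp : dist p c = r) (hvw : v ≠ w) {e : ℂ} (he : e = v + w - 2 * c) (he0 : e ≠ 0)
    (hfar : e.re * v.re + e.im * v.im < e.re * p.re + e.im * p.im) :
    dist p v < dist v w ∧ dist p w < dist v w := by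
  have hv2 := Complex.dist_sq_eq v c
  have hw2 := Complex.dist_sq_eq w c
  have hp2 := Complex.dist_sq_eq p c
  rw [hv] at hv2
  rw [hw] at hw2
  rw [hp] at hp2
  have hre : e.re = v.re + w.re - 2 * c.re := by simp [he]
  have him : e.im = v.im + w.im - 2 * c.im := by simp [he]
  have hvw0 : 0 < dist v w ^ 2 := by
    have := dist_pos.2 hvw
    positivity
  have he0 : 0 < e.re ^ 2 + e.im ^ 2 := by
    have h1 := Complex.normSq_pos.2 he0
    rw [Complex.normSq_apply] at h1
    nlinarith
  rw [Complex.dist_sq_eq] at hvw0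
  rw [hre, him] at he0 hfar
  have key := inner_lt_of_beyond_chord (m₁ := (v.re + w.re) / 2 - c.re)
    (m₂ := (v.im + w.im) / 2 - c.im) (d₁ := (w.re - v.re) / 2) (d₂ := (w.im - v.im) / 2)
    (p₁ := p.re - c.re) (p₂ := p.im - c.im) (by linarith) (by linarith) (by linarith)
    (by linarith) (by nlinarith)
  rw [abs_lt] at key
  constructor
  · refine lt_of_pow_lt_pow_left₀ 2 dist_nonneg ?_
    rw [Complex.dist_sq_eq, Complex.dist_sq_eq]
    nlinarith [key.1, key.2]
  · refine lt_of_pow_lt_pow_left₀ 2 dist_nonneg ?_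
    rw [Complex.dist_sq_eq, Complex.dist_sq_eq]
    nlinarith [key.1, key.2]

theorem IsOpen.lt_of_forall_le {f : Set ℂ} (hf : IsOpen f) (g : ℂ →L[ℝ] ℝ) {G : ℝ} {e : ℂ}
    (hle : ∀ x ∈ f, g x ≤ G) (he : 0 < g e) : ∀ x ∈ f, g x < G := by
  intro x hx
  have hcont : ContinuousAt (fun t : ℝ => x + t • e) 0 := by fun_prop
  have hev : ∀ᶠ t in nhds (0 : ℝ), x + t • e ∈ f :=
    hcont.eventually_mem (by simpa using hf.mem_nhds hx)
  obtain ⟨t, ht, ht0⟩ := ((hev.filter_mono nhdsWithin_le_nhds).and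
    (self_mem_nhdsWithin (s := Ioi (0 : ℝ)))).exists
  have h1 := hle _ ht
  rw [map_add, map_smul, smul_eq_mul] at h1
  have h2 : 0 < t * g e := mul_pos ht0 he
  linarith

theorem Complex.innerSL_real_apply (e x : ℂ) : innerSL ℝ e x = e.re * x.re + e.im * x.im := by
  rw [innerSL_apply_apply, Complex.inner]
  simp
  ring

/-! ### Sides of a face are edges -/

namespace PlaneGraph

variable {Γ : PlaneGraph} {h : ℝ} {f : Set ℂ}

/-- A chord between two corners that has the whole face on one side is an edge of the graph. -/
theorem adj_of_side (hf : f ∈ Γ.faces) (H : Γ.IsoradialFace h f) {v w : Γ.V}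
    (hv : (v : ℂ) ∈ Γ.corners f) (hw : (w : ℂ) ∈ Γ.corners f) (hvw : v ≠ w) {g : ℂ →L[ℝ] ℝ}
    {G : ℝ} (hgv : g v = G) (hgw : g w = G) (hg : ∀ x ∈ f, g x < G) : Γ.graph.Adj v w := by
  obtain ⟨c, hcf, hc⟩ := H.2
  have hvw' : (v : ℂ) ≠ w := fun h0 => hvw (Subtype.ext h0)
  have hpos : 0 < dist (v : ℂ) w ^ 2 := by
    have := dist_pos.2 hvw'
    positivity
  have hv2 := Complex.dist_sq_eq v c
  have hw2 := Complex.dist_sq_eq w c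
  rw [hc _ hv] at hv2
  rw [hc _ hw] at hw2
  rw [Complex.dist_sq_eq] at hpos
  -- the circle meets the chord only in its endpoints
  have hchord : ∀ p ∈ Γ.corners f, p ∈ segment ℝ (v : ℂ) w → p = v ∨ p = w := by
    rintro p hp ⟨s, t, hs, ht, hst, rfl⟩
    have hp2 := Complex.dist_sq_eq (s • (v : ℂ) + t • (w : ℂ)) c
    rw [hc _ hp] at hp2
    simp only [Complex.add_re, Complex.add_im, Complex.smul_re, Complex.smul_im,
      smul_eq_mul] at hp2
    obtain rfl : s = 1 - t := by linarith
    have h1 : (1 - t) * t * (((v : ℂ).re - (w : ℂ).re) ^ 2 + ((v : ℂ).im - (w : ℂ).im) ^ 2) =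
        0 := by
      linear_combination hp2 - (1 - t) * hv2 - t * hw2
    rcases mul_eq_zero.1 h1 with h2 | h2
    · rcases mul_eq_zero.1 h2 with h3 | h3
      · obtain rfl : t = 1 := by linarith
        simp
      · simp [h3]
    · exact absurd h2 hpos.ne'
  obtain ⟨z, hz, hzv, hzw⟩ : ∃ z ∈ openSegment ℝ (v : ℂ) w, z ≠ v ∧ z ≠ w := by
    have hmem : (1 / 2 : ℝ) • (v : ℂ) + (1 / 2 : ℝ) • (w : ℂ) ∈ openSegment ℝ (v : ℂ) w :=
      ⟨1 / 2, 1 / 2, by norm_num, by norm_num, by norm_num, rfl⟩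
    exact ⟨_, hmem, fun h0 => hvw' (left_mem_openSegment_iff.1 (h0 ▸ hmem)),
      fun h0 => hvw' (right_mem_openSegment_iff.1 (h0 ▸ hmem))⟩
  have hzs := openSegment_subset_segment ℝ _ _ hz
  have hgz : g z = G := by
    obtain ⟨s, t, -, -, hst, rfl⟩ := hz
    rw [map_add, map_smul, map_smul, hgv, hgw, ← add_smul, hst, one_smul]
  have hzcl : z ∈ closure f := H.convex.closure.segment_subset (frontier_subset_closure hv.2)
    (frontier_subset_closure hw.2) hzs
  have hzfr : z ∈ frontier f :=
    ⟨hzcl, fun hzi => (hg z (interior_subset hzi)).ne hgz⟩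
  have hzV : z ∉ Γ.V := fun hzV => by
    rcases hchord z ⟨hzV, hzfr⟩ hzs with h0 | h0
    exacts [hzv h0, hzw h0]
  obtain ⟨a, b, hab, hz'⟩ := exists_adj_of_mem_skeleton (frontier_subset_skeleton hf hzfr) hzV
  obtain ⟨ha, hb⟩ := mem_corners_of_mem_openSegment hf H hzfr hab hz'
  obtain ⟨has, hbs⟩ := edge_subset_side hf H hv hw hvw' hz (by rwa [hgz]) (by rw [hgv, hgz])
    (by rw [hgw, hgz]) hab hz'
  rcases hchord _ ha has with h1 | h1 <;> rcases hchord _ hb hbs with h2 | h2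
  · exact absurd (Subtype.ext (h1.trans h2.symm)) hab.ne
  · rwa [← Subtype.ext h1, ← Subtype.ext h2]
  · rw [← Subtype.ext h1, ← Subtype.ext h2]
    exact hab.symm
  · exact absurd (Subtype.ext (h1.trans h2.symm)) hab.ne

/-- Two corners of a face are adjacent if no other corner is closer to both of them than they are
to each other: a corner beyond their chord would be. -/
theorem adj_of_closest (hf : f ∈ Γ.faces) (H : Γ.IsoradialFace h f) {v w : Γ.V}
    (hv : (v : ℂ) ∈ Γ.corners f) (hw : (w : ℂ) ∈ Γ.corners f) (hvw : v ≠ w)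
    (hmin : ∀ p ∈ Γ.corners f, p ≠ v → p ≠ w →
      dist (v : ℂ) w ≤ dist p (v : ℂ) ∨ dist (v : ℂ) w ≤ dist p (w : ℂ)) : Γ.graph.Adj v w := by
  obtain ⟨c, hcf, hc⟩ := H.2
  have hvw' : (v : ℂ) ≠ w := fun h0 => hvw (Subtype.ext h0)
  have hv2 := Complex.dist_sq_eq v c
  have hw2 := Complex.dist_sq_eq w c
  rw [hc _ hv] at hv2
  rw [hc _ hw] at hw2
  obtain ⟨e, he⟩ : ∃ e : ℂ, e = v + w - 2 * c := ⟨_, rfl⟩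
  have hre : e.re = (v : ℂ).re + (w : ℂ).re - 2 * c.re := by simp [he]
  have him : e.im = (v : ℂ).im + (w : ℂ).im - 2 * c.im := by simp [he]
  by_cases he0 : e = 0
  · -- `v` and `w` are antipodal, and a third corner is closer than that to both
    exfalso
    obtain ⟨p, hp, hpv, hpw⟩ := H.exists_corner_ne v w
    have hp2 := Complex.dist_sq_eq p c
    rw [hc _ hp] at hp2
    rw [he0] at hre him
    simp only [Complex.zero_re, Complex.zero_im] at hre him
    have hanti : dist p (v : ℂ) ^ 2 + dist p (w : ℂ) ^ 2 = dist (v : ℂ) w ^ 2 := by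
      rw [Complex.dist_sq_eq, Complex.dist_sq_eq, Complex.dist_sq_eq]
      have h1 : (w : ℂ).re = 2 * c.re - (v : ℂ).re := by linarith
      have h2 : (w : ℂ).im = 2 * c.im - (v : ℂ).im := by linarith
      rw [h1, h2]
      linear_combination 2 * hv2 - 2 * hp2
    have h1 := dist_pos.2 hpv
    have h2 := dist_pos.2 hpw
    rcases hmin p hp hpv hpw with h3 | h3
    · have := pow_le_pow_left₀ dist_nonneg h3 2
      nlinarith
    · have := pow_le_pow_left₀ dist_nonneg h3 2
      nlinarith
  · have hgvw : innerSL ℝ e (w : ℂ) = innerSL ℝ e (v : ℂ) := by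
      rw [Complex.innerSL_real_apply, Complex.innerSL_real_apply, hre, him]
      linear_combination hv2 - hw2
    have hcor : ∀ p ∈ Γ.corners f, innerSL ℝ e p ≤ innerSL ℝ e (v : ℂ) := by
      intro p hp
      by_contra! hlt
      have hpv : p ≠ v := by
        rintro rfl
        exact lt_irrefl _ hlt
      have hpw : p ≠ w := by
        rintro rfl
        exact hlt.ne' hgvw
      rw [Complex.innerSL_real_apply, Complex.innerSL_real_apply] at hlt
      have h1 := dist_lt_of_beyond_chord (hc _ hv) (hc _ hw) (hc _ hp) hvw' he he0 hlt
      rcases hmin p hp hpv hpw with h3 | h3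
      · linarith [h1.1]
      · linarith [h1.2]
    have hle : ∀ x ∈ f, innerSL ℝ e x ≤ innerSL ℝ e (v : ℂ) := by
      intro x hx
      have hx' := subset_closure hx
      rw [H.closure_eq] at hx'
      exact convexHull_min (t := {x | innerSL ℝ e x ≤ innerSL ℝ e (v : ℂ)}) hcor
        (convex_halfSpace_le (innerSL ℝ e).isLinear _) hx'
    refine adj_of_side hf H hv hw hvw rfl hgvw (H.isOpen.lt_of_forall_le _ (e := e) hle ?_)
    rw [innerSL_apply_apply, real_inner_self_eq_norm_sq]
    have := norm_pos_iff.2 he0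
    positivity

/-- The corners of a face are as far from each other as adjacent vertices are. -/
theorem le_dist_of_mem_corners (hf : f ∈ Γ.faces) (H : Γ.IsoradialFace h f) {s : ℝ}
    (hs : ∀ u v : Γ.V, Γ.graph.Adj u v → s ≤ dist (u : ℂ) v) {v w : ℂ} (hv : v ∈ Γ.corners f)
    (hw : w ∈ Γ.corners f) (hvw : v ≠ w) : s ≤ dist v w := by
  classical
  obtain ⟨⟨a, b⟩, hab, hmin⟩ := Finset.exists_min_image H.finite_corners.toFinset.offDiag
    (fun p => dist p.1 p.2) ⟨(v, w), by simp [hv, hw, hvw]⟩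
  simp only [Finset.mem_offDiag, Set.Finite.mem_toFinset, Prod.forall] at hab hmin
  obtain ⟨ha, hb, hab⟩ := hab
  have hadj : Γ.graph.Adj ⟨a, ha.1⟩ ⟨b, hb.1⟩ := adj_of_closest hf H ha hb
    (fun h0 => hab (congrArg Subtype.val h0))
    fun p hp hpa _ => Or.inl (hmin p a ⟨hp, ha, hpa⟩)
  exact (hs _ _ hadj).trans (hmin v w ⟨hv, hw, hvw⟩)

/-- The corners of a face cannot be split into two nonempty classes without an edge between
them: a closest pair of corners from different classes is an edge. -/
theorem exists_adj_of_corners_split (hf : f ∈ Γ.faces) (H : Γ.IsoradialFace h f) {T : Set Γ.V}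
    {v w : Γ.V} (hv : (v : ℂ) ∈ Γ.corners f) (hw : (w : ℂ) ∈ Γ.corners f) (hvT : v ∈ T)
    (hwT : w ∉ T) : ∃ a b : Γ.V, (a : ℂ) ∈ Γ.corners f ∧ (b : ℂ) ∈ Γ.corners f ∧ a ∈ T ∧ b ∉ T ∧
      Γ.graph.Adj a b := by
  classical
  have hfin : {p : Γ.V | (p : ℂ) ∈ Γ.corners f}.Finite :=
    H.finite_corners.preimage Subtype.val_injective.injOn
  obtain ⟨⟨a, b⟩, hab, hmin⟩ := Finset.exists_min_image
    ((hfin.toFinset ×ˢ hfin.toFinset).filter fun p => p.1 ∈ T ∧ p.2 ∉ T)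
    (fun p => dist (p.1 : ℂ) p.2) ⟨(v, w), by simp [hv, hw, hvT, hwT]⟩
  simp only [Finset.mem_filter, Finset.mem_product, Set.Finite.mem_toFinset, mem_ofPred_eq,
    Prod.forall] at hab hmin
  obtain ⟨⟨ha, hb⟩, haT, hbT⟩ := hab
  refine ⟨a, b, ha, hb, haT, hbT, adj_of_closest hf H ha hb (fun h0 => hbT (h0 ▸ haT)) ?_⟩
  intro p hp hpa hpb
  by_cases hpT : (⟨p, hp.1⟩ : Γ.V) ∈ T
  · exact Or.inr (hmin ⟨p, hp.1⟩ b ⟨⟨hp, hb⟩, hpT, hbT⟩)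
  · left
    rw [dist_comm p]
    exact hmin a ⟨p, hp.1⟩ ⟨⟨ha, hp⟩, haT, hpT⟩

theorem IsoradialFace.eq_of_isCircumcenter (H : Γ.IsoradialFace h f) {c c' : ℂ} (hcf : c ∈ f)
    (hc : ∀ v ∈ Γ.corners f, dist v c = h / 2) (hc' : Γ.IsCircumcenter f c') : c' = c := by
  obtain ⟨r, hr⟩ := hc'
  by_contra hne
  obtain ⟨v, hv, -⟩ := H.exists_corner_ne 0 0
  obtain ⟨e, he⟩ : ∃ e : ℂ, e = c' - c := ⟨_, rfl⟩
  have hre : e.re = c'.re - c.re := by simp [he]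
  have him : e.im = c'.im - c.im := by simp [he]
  have hcor : ∀ p ∈ Γ.corners f, innerSL ℝ e p = innerSL ℝ e v := by
    intro p hp
    have h1 := Complex.dist_sq_eq p c
    have h2 := Complex.dist_sq_eq p c'
    have h3 := Complex.dist_sq_eq v c
    have h4 := Complex.dist_sq_eq v c'
    rw [hc _ hp] at h1
    rw [hr _ hp] at h2
    rw [hc _ hv] at h3
    rw [hr _ hv] at h4
    rw [Complex.innerSL_real_apply, Complex.innerSL_real_apply, hre, him]
    linear_combination (h2 - h1 - h4 + h3) / 2
  have hall : ∀ x ∈ f, innerSL ℝ e x = innerSL ℝ e v := by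
    intro x hx
    have hx' := subset_closure hx
    rw [H.closure_eq] at hx'
    exact convexHull_min (t := {x | innerSL ℝ e x = innerSL ℝ e v}) hcor
      (convex_hyperplane (innerSL ℝ e).isLinear _) hx'
  refine (H.isOpen.lt_of_forall_le _ (e := e) (fun x hx => (hall x hx).le) ?_ c hcf).ne (hall c hcf)
  rw [innerSL_apply_apply, real_inner_self_eq_norm_sq]
  have := norm_pos_iff.2 (he ▸ sub_ne_zero.2 hne : e ≠ 0)
  positivity

/-- Both ends of a dual edge are at distance `h / 2` from the endpoints of the edge. -/
theorem IsIsoradial.dualLength_le (H : Γ.IsIsoradial h) (hh : 0 ≤ h) (u v : Γ.V) :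
    Γ.dualLength u v ≤ h := by
  have key : ∀ c ∈ Γ.dualEnds u v, dist (u : ℂ) c = h / 2 := by
    rintro c ⟨f, hf, huv, hc⟩
    obtain ⟨c₀, hcf, hc₀⟩ := (H f hf).2
    rw [(H f hf).eq_of_isCircumcenter hcf hc₀ hc]
    refine hc₀ _ ⟨u.2, ?_⟩
    have h1 := closure_mono huv
    rw [isClosed_frontier.closure_eq] at h1
    exact h1 (segment_subset_closure_openSegment (left_mem_segment ℝ _ _))
  refine diam_le_of_forall_dist_le hh fun x hx y hy => ?_
  have h1 := dist_triangle_left x y (u : ℂ)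
  rw [key x hx, key y hy] at h1
  linarith

end PlaneGraph

/-! ### Discs in triangles -/

theorem abs_cross_le {a b p q r : ℝ} (hr : 0 ≤ r) {ρ : ℝ} (hρ : 0 ≤ ρ)
    (hab : a ^ 2 + b ^ 2 ≤ ρ ^ 2) (hpq : p ^ 2 + q ^ 2 ≤ r ^ 2) : |a * q - b * p| ≤ ρ * r := by
  refine abs_le_of_sq_le_sq ?_ (by positivity)
  calc (a * q - b * p) ^ 2 ≤ (a ^ 2 + b ^ 2) * (p ^ 2 + q ^ 2) := by
        nlinarith [sq_nonneg (a * p + b * q)]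
    _ ≤ ρ ^ 2 * r ^ 2 := by gcongr
    _ = (ρ * r) ^ 2 := by ring

theorem Convex.add_add_smul_mem {S : Set ℂ} (hS : Convex ℝ S) {x y z : ℂ} (hx : x ∈ S)
    (hy : y ∈ S) (hz : z ∈ S) {a b c : ℝ} (ha : 0 ≤ a) (hb : 0 ≤ b) (hc : 0 ≤ c)
    (habc : a + b + c = 1) : a • x + b • y + c • z ∈ S := by
  have hcomb := hS.sum_mem (t := Finset.univ) (w := ![a, b, c]) (z := ![x, y, z])
    (fun i _ => by fin_cases i <;> assumption) (by simpa [Fin.sum_univ_three] using habc)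
    (fun i _ => by fin_cases i <;> assumption)
  simpa only [Fin.sum_univ_three, Matrix.cons_val] using hcomb

/-- The doubled area `D` of a triangle on a circle of diameter `h`, by the formula
`D = a b c / h` in terms of the side lengths.  The vectors `p`, `q` are two sides starting at the
point `x` of the circle. -/
theorem sq_mul_cross_eq {x₁ x₂ p₁ p₂ q₁ q₂ h : ℝ} (hx : (h / 2) ^ 2 = x₁ ^ 2 + x₂ ^ 2)
    (hp : (h / 2) ^ 2 = (x₁ + p₁) ^ 2 + (x₂ + p₂) ^ 2)
    (hq : (h / 2) ^ 2 = (x₁ + q₁) ^ 2 + (x₂ + q₂) ^ 2) :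
    (h * (p₁ * q₂ - p₂ * q₁)) ^ 2 =
      (p₁ ^ 2 + p₂ ^ 2) * (q₁ ^ 2 + q₂ ^ 2) * ((p₁ - q₁) ^ 2 + (p₂ - q₂) ^ 2) := by
  have hA : 2 * (x₁ * p₁ + x₂ * p₂) = -(p₁ ^ 2 + p₂ ^ 2) := by
    linear_combination hx - hp
  have hB : 2 * (x₁ * q₁ + x₂ * q₂) = -(q₁ ^ 2 + q₂ ^ 2) := by
    linear_combination hx - hq
  calc (h * (p₁ * q₂ - p₂ * q₁)) ^ 2
      = (2 * (x₁ * p₁ + x₂ * p₂)) ^ 2 * (q₁ ^ 2 + q₂ ^ 2) -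
        2 * (2 * (x₁ * p₁ + x₂ * p₂)) * (2 * (x₁ * q₁ + x₂ * q₂)) * (p₁ * q₁ + p₂ * q₂) +
        (2 * (x₁ * q₁ + x₂ * q₂)) ^ 2 * (p₁ ^ 2 + p₂ ^ 2) := by
        linear_combination 4 * (p₁ * q₂ - p₂ * q₁) ^ 2 * hx
    _ = _ := by
        rw [hA, hB]
        ring

/-- A triangle with sides of length at most `h` and doubled area at least `3 ρ h` contains the ball
of radius `ρ` about its centroid. -/
theorem ball_centroid_subset_convexHull {v₁ v₂ v₃ : ℂ} {h ρ p₁ p₂ q₁ q₂ D : ℝ} (hh : 0 ≤ h)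
    (hρ0 : 0 ≤ ρ) (hp₁ : p₁ = v₁.re - v₂.re) (hp₂ : p₂ = v₁.im - v₂.im)
    (hq₁ : q₁ = v₃.re - v₂.re) (hq₂ : q₂ = v₃.im - v₂.im) (lp : p₁ ^ 2 + p₂ ^ 2 ≤ h ^ 2)
    (lq : q₁ ^ 2 + q₂ ^ 2 ≤ h ^ 2) (lpq : (p₁ - q₁) ^ 2 + (p₂ - q₂) ^ 2 ≤ h ^ 2)
    (hD : D = p₁ * q₂ - p₂ * q₁) (hD0 : D ≠ 0) (hρh : ρ * h ≤ |D| / 3) :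
    ball ((1 / 3 : ℝ) • v₁ + (1 / 3 : ℝ) • v₂ + (1 / 3 : ℝ) • v₃) ρ ⊆
      convexHull ℝ {v₁, v₂, v₃} := by
  intro x hx
  rw [mem_ball] at hx
  have hx2 := pow_le_pow_left₀ dist_nonneg hx.le 2
  rw [Complex.dist_sq_eq] at hx2
  obtain ⟨a, ha⟩ : ∃ a, a = x.re - (1 / 3 * v₁.re + 1 / 3 * v₂.re + 1 / 3 * v₃.re) := ⟨_, rfl⟩
  obtain ⟨b, hb⟩ : ∃ b, b = x.im - (1 / 3 * v₁.im + 1 / 3 * v₂.im + 1 / 3 * v₃.im) := ⟨_, rfl⟩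
  have hab : a ^ 2 + b ^ 2 ≤ ρ ^ 2 := by
    rw [ha, hb]
    simpa only [Complex.add_re, Complex.add_im, Complex.smul_re, Complex.smul_im,
      smul_eq_mul] using hx2
  have hbary : ∀ y₁ y₂ : ℝ, y₁ ^ 2 + y₂ ^ 2 ≤ h ^ 2 → 0 ≤ 1 / 3 + (a * y₂ - b * y₁) / D := by
    intro y₁ y₂ hy
    have h1 : |(a * y₂ - b * y₁) / D| ≤ 1 / 3 := by
      rw [abs_div, div_le_iff₀ (abs_pos.2 hD0)]
      refine (abs_cross_le hh hρ0 hab hy).trans ?_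
      rwa [one_div, inv_mul_eq_div]
    linarith [(abs_le.1 h1).1]
  -- `1 / 3 + L₁`, `1 / 3 - L₁ - L₃`, `1 / 3 + L₃` are the barycentric coordinates of `x`
  obtain ⟨L₁, hL₁⟩ : ∃ L₁, L₁ = (a * q₂ - b * q₁) / D := ⟨_, rfl⟩
  obtain ⟨L₃, hL₃⟩ : ∃ L₃, L₃ = (a * -p₂ - b * -p₁) / D := ⟨_, rfl⟩
  have b₁ : 0 ≤ 1 / 3 + L₁ := hL₁ ▸ hbary q₁ q₂ lq
  have b₃ : 0 ≤ 1 / 3 + L₃ := hL₃ ▸ hbary (-p₁) (-p₂) (by linarith)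
  have b₂ : 0 ≤ 1 / 3 - L₁ - L₃ := by
    refine (hbary (p₁ - q₁) (p₂ - q₂) lpq).trans_eq ?_
    rw [hL₁, hL₃]
    ring
  have hae : a = L₁ * p₁ + L₃ * q₁ := by
    rw [hL₁, hL₃]
    field_simp
    rw [hD]
    ring
  have hbe : b = L₁ * p₂ + L₃ * q₂ := by
    rw [hL₁, hL₃]
    field_simp
    rw [hD]
    ring
  have hx : x = (1 / 3 + L₁) • v₁ + (1 / 3 - L₁ - L₃) • v₂ + (1 / 3 + L₃) • v₃ := by
    apply Complex.ext
    · simp only [Complex.add_re, Complex.smul_re, smul_eq_mul]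
      rw [hp₁, hq₁] at hae
      linear_combination hae - ha
    · simp only [Complex.add_im, Complex.smul_im, smul_eq_mul]
      rw [hp₂, hq₂] at hbe
      linear_combination hbe - hb
  rw [hx]
  exact (convex_convexHull ℝ _).add_add_smul_mem (subset_convexHull ℝ _ (by simp))
    (subset_convexHull ℝ _ (by simp)) (subset_convexHull ℝ _ (by simp)) b₁ b₂ b₃ (by ring)

/-- Three points on a circle of diameter `h` at mutual distances at least `s` span a triangle that
contains a ball of radius `s³ / (3 h²)`. -/
theorem exists_ball_subset_convexHull {c v₁ v₂ v₃ : ℂ} {h s : ℝ} (hh : 0 < h) (hs : 0 < s)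
    (h₁ : dist v₁ c = h / 2) (h₂ : dist v₂ c = h / 2) (h₃ : dist v₃ c = h / 2)
    (h₁₂ : s ≤ dist v₁ v₂) (h₃₂ : s ≤ dist v₃ v₂) (h₁₃ : s ≤ dist v₁ v₃) :
    ∃ g, ball g (s ^ 3 / (3 * h ^ 2)) ⊆ convexHull ℝ {v₁, v₂, v₃} := by
  have hle : ∀ x y : ℂ, dist x c = h / 2 → dist y c = h / 2 → s ≤ dist x y →
      s ^ 2 ≤ (x.re - y.re) ^ 2 + (x.im - y.im) ^ 2 ∧
      (x.re - y.re) ^ 2 + (x.im - y.im) ^ 2 ≤ h ^ 2 := by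
    intro x y hx hy hxy
    have h1 := dist_triangle_right x y c
    rw [← Complex.dist_sq_eq]
    exact ⟨pow_le_pow_left₀ hs.le hxy 2, pow_le_pow_left₀ dist_nonneg (by linarith) 2⟩
  have l₁₂ := hle _ _ h₁ h₂ h₁₂
  have l₃₂ := hle _ _ h₃ h₂ h₃₂
  have l₁₃ := hle _ _ h₁ h₃ h₁₃
  have e₁ := Complex.dist_sq_eq v₁ c
  have e₂ := Complex.dist_sq_eq v₂ c
  have e₃ := Complex.dist_sq_eq v₃ c
  rw [h₁] at e₁
  rw [h₂] at e₂
  rw [h₃] at e₃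
  obtain ⟨D, hD⟩ : ∃ D, D = (v₁.re - v₂.re) * (v₃.im - v₂.im) - (v₁.im - v₂.im) * (v₃.re - v₂.re) :=
    ⟨_, rfl⟩
  have harea := sq_mul_cross_eq (p₁ := v₁.re - v₂.re) (p₂ := v₁.im - v₂.im)
    (q₁ := v₃.re - v₂.re) (q₂ := v₃.im - v₂.im) e₂ (by rw [e₁]; ring) (by rw [e₃]; ring)
  rw [sub_sub_sub_cancel_right, sub_sub_sub_cancel_right, ← hD] at harea
  have hDs : s ^ 3 ≤ h * |D| := by
    refine (pow_le_pow_iff_left₀ (by positivity) (by positivity) two_ne_zero).1 ?_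
    rw [mul_pow, sq_abs, ← mul_pow, harea]
    calc (s ^ 3) ^ 2 = s ^ 2 * s ^ 2 * s ^ 2 := by ring
      _ ≤ _ := by
        gcongr
        exacts [l₁₂.1, l₃₂.1, l₁₃.1]
  have hD0 : D ≠ 0 := by
    rintro h0
    rw [h0, abs_zero, mul_zero] at hDs
    have : 0 < s ^ 3 := by positivity
    linarith
  refine ⟨_, ball_centroid_subset_convexHull hh.le (by positivity) rfl rfl rfl rfl l₁₂.2 l₃₂.2 ?_
    hD hD0 ?_⟩
  · rw [sub_sub_sub_cancel_right, sub_sub_sub_cancel_right]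
    exact l₁₃.2
  · rw [div_mul_eq_mul_div, div_le_div_iff₀ (by positivity) (by positivity)]
    calc s ^ 3 * h * 3 ≤ h * |D| * h * 3 := by gcongr
      _ = |D| * (3 * h ^ 2) := by ring

/-! ### Square cells -/

/-- Two points of the lattice `ℤ × ℤ` differ by at most `k` in each coordinate. -/
def Near (k : ℕ) (p q : ℤ × ℤ) : Prop :=
  p.1 ≤ q.1 + k ∧ q.1 ≤ p.1 + k ∧ p.2 ≤ q.2 + k ∧ q.2 ≤ p.2 + k

theorem Near.symm {k : ℕ} {p q : ℤ × ℤ} (H : Near k p q) : Near k q p := by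
  unfold Near at *
  omega

theorem Near.refl (k : ℕ) (p : ℤ × ℤ) : Near k p p := by
  unfold Near
  omega

theorem Near.trans {k l m : ℕ} {p q r : ℤ × ℤ} (H : Near k p q) (H' : Near l q r)
    (hm : k + l ≤ m) : Near m p r := by
  unfold Near at *
  omega

/-- The lattice points that differ from `p` by at most `k` in each coordinate. -/
noncomputable def squareBox (p : ℤ × ℤ) (k : ℕ) : Finset (ℤ × ℤ) :=
  Finset.Icc (p.1 - k) (p.1 + k) ×ˢ Finset.Icc (p.2 - k) (p.2 + k)

theorem mem_squareBox {p q : ℤ × ℤ} {k : ℕ} : q ∈ squareBox p k ↔ Near k p q := by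
  unfold Near squareBox
  rw [Finset.mem_product, Finset.mem_Icc, Finset.mem_Icc]
  omega

theorem card_squareBox (p : ℤ × ℤ) (k : ℕ) : (squareBox p k).card = (2 * k + 1) ^ 2 := by
  unfold squareBox
  rw [Finset.card_product, Int.card_Icc, Int.card_Icc, sq]
  congr 1 <;> omega

/-- The index of the square of the grid of mesh `l` that contains `z`. -/
noncomputable def gridCell (l : ℝ) (z : ℂ) : ℤ × ℤ := (⌊z.re / l⌋, ⌊z.im / l⌋)

theorem near_gridCell {l : ℝ} (hl : 0 < l) {x y : ℂ} {k : ℕ} (hxy : dist x y ≤ k * l) :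
    Near k (gridCell l x) (gridCell l y) := by
  have h1 : |x.re - y.re| ≤ k * l := by
    rw [← Complex.sub_re]
    exact (Complex.abs_re_le_norm _).trans (by rwa [← Complex.dist_eq])
  have h2 : |x.im - y.im| ≤ k * l := by
    rw [← Complex.sub_im]
    exact (Complex.abs_im_le_norm _).trans (by rwa [← Complex.dist_eq])
  have key : ∀ a b : ℝ, a - b ≤ k * l → ⌊a / l⌋ ≤ ⌊b / l⌋ + k := by
    intro a b hab
    rw [← Int.floor_add_natCast]
    apply Int.floor_le_floor
    rw [div_le_iff₀ hl, add_mul, div_mul_cancel₀ _ hl.ne']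
    linarith
  rw [abs_le] at h1 h2
  exact ⟨key _ _ (by linarith), key _ _ (by linarith), key _ _ (by linarith),
    key _ _ (by linarith)⟩

theorem dist_lt_of_near_gridCell {l : ℝ} (hl : 0 < l) {x y : ℂ} {k : ℕ}
    (hxy : Near k (gridCell l x) (gridCell l y)) : dist x y < 2 * (k + 1) * l := by
  have key : ∀ a b : ℝ, ⌊a / l⌋ ≤ ⌊b / l⌋ + k → a - b < (k + 1) * l := by
    intro a b hab
    have h1 := Int.lt_floor_add_one (a / l)
    have h2 := Int.floor_le (b / l)
    have h3 : (⌊a / l⌋ : ℝ) ≤ ⌊b / l⌋ + k := by exact_mod_cast hab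
    have h4 : a / l - b / l < k + 1 := by linarith
    rwa [← sub_div, div_lt_iff₀ hl] at h4
  obtain ⟨h1, h2, h3, h4⟩ := hxy
  have g1 := key _ _ h1
  have g2 := key _ _ h2
  have g3 := key _ _ h3
  have g4 := key _ _ h4
  have h5 := Complex.norm_le_abs_re_add_abs_im (x - y)
  rw [← Complex.dist_eq, Complex.sub_re, Complex.sub_im] at h5
  have h6 : |x.re - y.re| < (k + 1) * l := abs_lt.2 ⟨by linarith, by linarith⟩
  have h7 : |x.im - y.im| < (k + 1) * l := abs_lt.2 ⟨by linarith, by linarith⟩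
  linarith

/-! ### Counting vertices and joining them by short paths -/

namespace PlaneGraph

variable {Γ : PlaneGraph} {h : ℝ}

theorem exists_ball_subset_face {f : Set ℂ} (hh : 0 < h) (hf : f ∈ Γ.faces)
    (H : Γ.IsoradialFace h f) {s : ℝ} (hs0 : 0 < s)
    (hs : ∀ u v : Γ.V, Γ.graph.Adj u v → s ≤ dist (u : ℂ) v) :
    ∃ g, Metric.ball g (s ^ 3 / (3 * h ^ 2)) ⊆ f := by
  obtain ⟨c, -, hc⟩ := H.2
  obtain ⟨v₁, hv₁, -⟩ := H.exists_corner_ne 0 0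
  obtain ⟨v₂, hv₂, h₂₁, -⟩ := H.exists_corner_ne v₁ v₁
  obtain ⟨v₃, hv₃, h₃₁, h₃₂⟩ := H.exists_corner_ne v₁ v₂
  obtain ⟨g, hg⟩ := exists_ball_subset_convexHull hh hs0 (hc _ hv₁) (hc _ hv₂) (hc _ hv₃)
    (le_dist_of_mem_corners hf H hs hv₁ hv₂ h₂₁.symm)
    (le_dist_of_mem_corners hf H hs hv₃ hv₂ h₃₂)
    (le_dist_of_mem_corners hf H hs hv₁ hv₃ h₃₁.symm)
  refine ⟨g, ?_⟩
  rw [H.1]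
  refine interior_maximal (hg.trans (convexHull_mono ?_)) isOpen_ball
  rintro x (rfl | rfl | rfl) <;> assumption

/-- A disc of radius `K h` contains at most `M` vertices: a vertex is determined by the grid cell
of the center of a ball inside a face that has it as a corner, and by its own grid cell. -/
theorem exists_card_bound {κ : ℝ} (hκ : 0 < κ) (K : ℝ) : ∃ M : ℕ, ∀ (Γ : PlaneGraph) (h : ℝ),
    0 < h → Γ.IsIsoradial h → (∀ u v : Γ.V, Γ.graph.Adj u v → κ * h ≤ dist (u : ℂ) v) →
    ∀ z : ℂ, {v : Γ.V | dist (v : ℂ) z ≤ K * h}.Finite ∧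
      {v : Γ.V | dist (v : ℂ) z ≤ K * h}.ncard ≤ M := by
  obtain ⟨k₁, hk₁⟩ := exists_nat_ge (6 * (K + 1) / κ ^ 3)
  obtain ⟨k₂, hk₂⟩ := exists_nat_ge (2 * K / κ)
  refine ⟨(2 * k₁ + 1) ^ 2 * (2 * k₂ + 1) ^ 2, fun Γ h hh H hs z => ?_⟩
  have hfin : {v : Γ.V | dist (v : ℂ) z ≤ K * h}.Finite := by
    refine ((Γ.finite_vertices _ (isCompact_closedBall z (K * h))).preimage
      Subtype.val_injective.injOn).subset fun v hv => ⟨v.2, hv⟩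
  refine ⟨hfin, ?_⟩
  have hs0 : 0 < κ * h := by positivity
  have hface : ∀ v : Γ.V, ∃ f, f ∈ Γ.faces ∧ (v : ℂ) ∈ Γ.corners f := by
    intro v
    obtain ⟨f, hf, hv⟩ := H.exists_mem_closure_face v
    exact ⟨f, hf, mem_corners_of_mem_closure hf v.2 hv⟩
  choose F hF hvF using hface
  have hcen : ∀ f : Γ.faces, ∃ g, Metric.ball g ((κ * h) ^ 3 / (3 * h ^ 2)) ⊆ f.1 := fun f =>
    exists_ball_subset_face hh f.2 (H _ f.2) hs0 hs
  choose g hg using hcen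
  obtain ⟨ρ, hρ⟩ : ∃ ρ, ρ = (κ * h) ^ 3 / (3 * h ^ 2) := ⟨_, rfl⟩
  have hρ0 : 0 < ρ := by rw [hρ]; positivity
  have hρ' : ρ = κ ^ 3 * h / 3 := by rw [hρ]; field_simp
  rw [← hρ] at hg
  have hgf : ∀ f, g f ∈ f.1 := fun f => hg f (mem_ball_self hρ0)
  have hcard : (((squareBox (gridCell (ρ / 2) z) k₁) ×ˢ (squareBox (gridCell (κ * h / 2) z) k₂) :
      Finset _) : Set ((ℤ × ℤ) × (ℤ × ℤ))).ncard = (2 * k₁ + 1) ^ 2 * (2 * k₂ + 1) ^ 2 := by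
    rw [ncard_coe_finset, Finset.card_product, card_squareBox, card_squareBox]
  rw [← hcard]
  refine ncard_le_ncard_of_injOn
    (fun v => (gridCell (ρ / 2) (g ⟨F v, hF v⟩), gridCell (κ * h / 2) v)) ?_ ?_
    (Finset.finite_toSet _)
  · intro v hv
    have hv : dist (v : ℂ) z ≤ K * h := hv
    rw [Finset.coe_product, Set.mem_prod, Finset.mem_coe, Finset.mem_coe, mem_squareBox,
      mem_squareBox]
    constructor
    · refine (near_gridCell (by positivity) ?_).symm
      have h1 := (H _ (hF v)).dist_le (subset_closure (hgf ⟨F v, hF v⟩))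
        (frontier_subset_closure (hvF v).2)
      have h2 : dist (g ⟨F v, hF v⟩) z ≤ (K + 1) * h := by
        linarith [dist_triangle (g ⟨F v, hF v⟩) v z]
      refine h2.trans ?_
      rw [div_le_iff₀ (by positivity)] at hk₁
      rw [hρ']
      nlinarith
    · refine (near_gridCell (by positivity) ?_).symm
      refine hv.trans ?_
      rw [div_le_iff₀ hκ] at hk₂
      nlinarith
  · intro v _ w _ hvw
    obtain ⟨h1, h2⟩ := Prod.ext_iff.1 hvw
    simp only at h1 h2
    have h3 : dist (g ⟨F v, hF v⟩) (g ⟨F w, hF w⟩) < _ :=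
      dist_lt_of_near_gridCell (k := 0) (half_pos hρ0) (by rw [h1]; exact Near.refl _ _)
    have h4 : g ⟨F w, hF w⟩ ∈ F v := by
      apply hg ⟨F v, hF v⟩
      rw [mem_ball, dist_comm]
      push_cast at h3
      linarith
    have h5 := faces_eq_of_mem (hF v) (hF w) h4 (hgf ⟨F w, hF w⟩)
    by_contra hne
    have h6 := le_dist_of_mem_corners (hF v) (H _ (hF v)) hs (hvF v) (h5 ▸ hvF w)
      fun h0 => hne (Subtype.ext h0)
    have h7 : dist (v : ℂ) w < _ := dist_lt_of_near_gridCell (k := 0)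
      (half_pos hs0) (by rw [h2]; exact Near.refl _ _)
    push_cast at h7
    linarith

/-- The corners of the faces that touch the segment from `u` to `v` carry a path from `u` to `v`:
otherwise the segment would be the union of two disjoint closed sets. -/
theorem IsIsoradial.edist_le_ncard (H : Γ.IsIsoradial h) {u v : Γ.V} {W : Set Γ.V}
    (hW : W = {x : Γ.V | ∃ f ∈ Γ.faces, (x : ℂ) ∈ Γ.corners f ∧
      (segment ℝ (u : ℂ) v ∩ closure f).Nonempty}) (hfin : W.Finite) :
    Γ.graph.edist u v ≤ W.ncard := by
  classical
  have hend : ∀ x : Γ.V, (x : ℂ) ∈ segment ℝ (u : ℂ) v → ∃ f ∈ Γ.faces, (x : ℂ) ∈ Γ.corners f ∧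
      (segment ℝ (u : ℂ) v ∩ closure f).Nonempty := by
    intro x hx
    obtain ⟨f, hf, hxf⟩ := H.exists_mem_closure_face x
    exact ⟨f, hf, mem_corners_of_mem_closure hf x.2 hxf, x, hx, hxf⟩
  have huW : u ∈ W := hW ▸ hend u (left_mem_segment ℝ _ _)
  have hvW : v ∈ W := hW ▸ hend v (right_mem_segment ℝ _ _)
  have hreach : (Γ.graph.induce W).Reachable ⟨u, huW⟩ ⟨v, hvW⟩ := by
    by_contra hnot
    obtain ⟨T, hT⟩ : ∃ T : Set Γ.V,
        T = {x | ∃ hx : x ∈ W, (Γ.graph.induce W).Reachable ⟨u, huW⟩ ⟨x, hx⟩} := ⟨_, rfl⟩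
    have huT : u ∈ T := hT ▸ ⟨huW, SimpleGraph.Reachable.refl _⟩
    have hvT : v ∉ T := by
      rw [hT]
      rintro ⟨_, h1⟩
      exact hnot h1
    have hface : ∀ f ∈ Γ.faces, (segment ℝ (u : ℂ) v ∩ closure f).Nonempty → ∀ a b : Γ.V,
        (a : ℂ) ∈ Γ.corners f → (b : ℂ) ∈ Γ.corners f → a ∈ T → b ∈ T := by
      intro f hf hmeet a b ha hb haT
      by_contra hbT
      obtain ⟨a', b', ha', hb', haT', hbT', hadj⟩ :=
        exists_adj_of_corners_split hf (H f hf) ha hb haT hbT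
      apply hbT'
      have hbW : b' ∈ W := hW ▸ ⟨f, hf, hb', hmeet⟩
      rw [hT] at haT' ⊢
      obtain ⟨haW, hr⟩ := haT'
      refine ⟨hbW, hr.trans (SimpleGraph.Adj.reachable ?_)⟩
      exact hadj
    have hFfin : {f | f ∈ Γ.faces ∧ (segment ℝ (u : ℂ) v ∩ closure f).Nonempty}.Finite := by
      refine Set.Finite.of_finite_image (f := Γ.corners)
        ((hfin.image Subtype.val).finite_subsets.subset ?_) ?_
      · rintro _ ⟨f, ⟨hf, hmeet⟩, rfl⟩ x hx
        exact ⟨⟨x, hx.1⟩, hW ▸ ⟨f, hf, hx, hmeet⟩, rfl⟩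
      · rintro f ⟨hf, -⟩ g ⟨hg, -⟩ hfg
        rw [(H f hf).1, (H g hg).1, hfg]
    have hclosed : ∀ P : Set ℂ → Prop, IsClosed (⋃ f ∈ {f | (f ∈ Γ.faces ∧
        (segment ℝ (u : ℂ) v ∩ closure f).Nonempty) ∧ P f}, closure f) := fun P =>
      (hFfin.subset fun f hf => hf.1).isClosed_biUnion fun f _ => isClosed_closure
    have hmem : ∀ P : Set ℂ → Prop, ∀ z, z ∈ (⋃ f ∈ {f | (f ∈ Γ.faces ∧
        (segment ℝ (u : ℂ) v ∩ closure f).Nonempty) ∧ P f}, closure f) ↔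
        ∃ f, (f ∈ Γ.faces ∧ (segment ℝ (u : ℂ) v ∩ closure f).Nonempty) ∧ P f ∧ z ∈ closure f := by
      intro P z
      simp only [mem_iUnion, exists_prop, mem_ofPred_eq, and_assoc]
    have hpre := isPreconnected_closed_iff.1 (convex_segment (u : ℂ) (v : ℂ)).isPreconnected
      _ _ (hclosed fun f => ∃ a : Γ.V, (a : ℂ) ∈ Γ.corners f ∧ a ∈ T)
      (hclosed fun f => ∃ a : Γ.V, (a : ℂ) ∈ Γ.corners f ∧ a ∉ T) ?_ ?_ ?_
    · obtain ⟨z, hzK, hz1, hz2⟩ := hpre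
      rw [hmem] at hz1 hz2
      obtain ⟨f, ⟨hf, hfm⟩, ⟨a, ha, haT⟩, hzf⟩ := hz1
      obtain ⟨g, ⟨hg, hgm⟩, ⟨b, hb, hbT⟩, hzg⟩ := hz2
      by_cases hfg : f = g
      · subst hfg
        exact hbT (hface f hf hfm a b ha hb haT)
      · obtain ⟨p, hpf, hpg⟩ := H.exists_common_corner hf hg hzf hzg hfg
        exact hbT (hface g hg hgm ⟨p, hpg.1⟩ b hpg hb (hface f hf hfm a ⟨p, hpf.1⟩ ha hpf haT))
    · intro z hz
      obtain ⟨f, hf, hzf⟩ := H.exists_mem_closure_face z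
      obtain ⟨p, hp, -⟩ := (H f hf).exists_corner_ne 0 0
      by_cases hpT : (⟨p, hp.1⟩ : Γ.V) ∈ T
      · exact Or.inl ((hmem _ _).2 ⟨f, ⟨hf, z, hz, hzf⟩, ⟨⟨p, hp.1⟩, hp, hpT⟩, hzf⟩)
      · exact Or.inr ((hmem _ _).2 ⟨f, ⟨hf, z, hz, hzf⟩, ⟨⟨p, hp.1⟩, hp, hpT⟩, hzf⟩)
    · obtain ⟨f, hf, hu, hm⟩ := hend u (left_mem_segment ℝ _ _)
      exact ⟨u, left_mem_segment ℝ _ _,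
        (hmem _ _).2 ⟨f, ⟨hf, hm⟩, ⟨u, hu, huT⟩, frontier_subset_closure hu.2⟩⟩
    · obtain ⟨f, hf, hv, hm⟩ := hend v (right_mem_segment ℝ _ _)
      exact ⟨v, right_mem_segment ℝ _ _,
        (hmem _ _).2 ⟨f, ⟨hf, hm⟩, ⟨v, hv, hvT⟩, frontier_subset_closure hv.2⟩⟩
  obtain ⟨p, hp⟩ := hreach.exists_isPath
  have : Fintype W := hfin.fintype
  have h1 := hp.length_lt
  have h2 := SimpleGraph.edist_le (p.map (SimpleGraph.Embedding.induce W).toHom)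
  rw [SimpleGraph.Walk.length_map] at h2
  refine h2.trans ?_
  rw [← Nat.card_coe_set_eq, Nat.card_eq_fintype_card]
  exact_mod_cast h1.le

/-- The graph distance is bounded by the Euclidean distance: a disc of radius `2 h` about a point
of the segment contains boundedly many vertices, so the faces along the segment have at most a
multiple of `|u - v| / h + 1` corners. -/
theorem exists_edist_bound {κ : ℝ} (hκ : 0 < κ) : ∃ D : ℕ, ∀ (Γ : PlaneGraph) (h : ℝ),
    0 < h → Γ.IsIsoradial h → (∀ u v : Γ.V, Γ.graph.Adj u v → κ * h ≤ dist (u : ℂ) v) →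
    ∀ (u v : Γ.V) (k : ℕ), dist (u : ℂ) v ≤ k * h →
      Γ.graph.edist u v ≤ ((D * (k + 1) : ℕ) : ℕ∞) := by
  obtain ⟨M, hM⟩ := exists_card_bound hκ 2
  refine ⟨2 * M, fun Γ h hh H hs u v k huv => ?_⟩
  obtain ⟨W, hW⟩ : ∃ W : Set Γ.V, W = {x : Γ.V | ∃ f ∈ Γ.faces, (x : ℂ) ∈ Γ.corners f ∧
      (segment ℝ (u : ℂ) v ∩ closure f).Nonempty} := ⟨_, rfl⟩
  -- the segment is covered by discs of radius `h` about `k + 2` equidistant points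
  obtain ⟨t, ht⟩ : ∃ t : ℕ → ℂ,
      t = fun i : ℕ => (u : ℂ) + ((i : ℝ) / (k + 1)) • ((v : ℂ) - u) := ⟨_, rfl⟩
  have hcover : W ⊆ ⋃ i ∈ Finset.range (k + 2), {x : Γ.V | dist (x : ℂ) (t i) ≤ 2 * h} := by
    intro x hx
    rw [hW] at hx
    obtain ⟨f, hf, hxf, y, hy, hyf⟩ := hx
    have h1 := (H f hf).dist_le (frontier_subset_closure hxf.2) hyf
    rw [segment_eq_image'] at hy
    obtain ⟨θ, ⟨hθ0, hθ1⟩, rfl⟩ := hy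
    have hk : (0 : ℝ) < k + 1 := by positivity
    have hf1 := Nat.floor_le (show 0 ≤ θ * (k + 1) by positivity)
    have hf2 := Nat.lt_floor_add_one (θ * (k + 1))
    refine mem_biUnion (x := ⌊θ * (k + 1)⌋₊) ?_ ?_
    · rw [Finset.coe_range, mem_Iio]
      have h2 : (⌊θ * (k + 1)⌋₊ : ℝ) ≤ ((k + 1 : ℕ) : ℝ) := by push_cast; nlinarith
      have h3 : ⌊θ * (k + 1)⌋₊ ≤ k + 1 := by exact_mod_cast h2
      omega
    · have h2 : dist ((u : ℂ) + θ • ((v : ℂ) - u)) (t ⌊θ * (k + 1)⌋₊) ≤ h := by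
        rw [ht]
        simp only
        rw [dist_add_left, dist_eq_norm, ← sub_smul, norm_smul, Real.norm_eq_abs, ← dist_eq_norm,
          dist_comm]
        have h3 : |θ - (⌊θ * (k + 1)⌋₊ : ℝ) / (k + 1)| ≤ 1 / (k + 1) := by
          rw [abs_le]
          constructor
          · have : (⌊θ * (k + 1)⌋₊ : ℝ) / (k + 1) ≤ θ := by rwa [div_le_iff₀ hk]
            have h4 : (0 : ℝ) ≤ 1 / (k + 1) := by positivity
            linarith
          · rw [sub_le_iff_le_add, ← add_div, le_div_iff₀ hk]
            linarith
        calc _ ≤ 1 / ((k : ℝ) + 1) * (k * h) := by gcongr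
          _ = k / (k + 1) * h := by ring
          _ ≤ 1 * h := by
            gcongr
            rw [div_le_one hk]
            linarith
          _ = h := one_mul h
      have h3 := dist_triangle (x : ℂ) ((u : ℂ) + θ • ((v : ℂ) - u)) (t ⌊θ * (k + 1)⌋₊)
      change dist (x : ℂ) (t ⌊θ * (k + 1)⌋₊) ≤ 2 * h
      simp only at h1
      linarith
  have hUfin : (⋃ i ∈ Finset.range (k + 2), {x : Γ.V | dist (x : ℂ) (t i) ≤ 2 * h}).Finite :=
    (Finset.range (k + 2)).finite_toSet.biUnion fun i _ => (hM Γ h hh H hs (t i)).1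
  have hcard : W.ncard ≤ (k + 2) * M := by
    refine (ncard_le_ncard hcover hUfin).trans ?_
    refine (Finset.set_ncard_biUnion_le _ _).trans ?_
    refine (Finset.sum_le_card_nsmul _ _ M fun i _ => (hM Γ h hh H hs (t i)).2).trans ?_
    rw [Finset.card_range, smul_eq_mul]
  refine (H.edist_le_ncard hW (hUfin.subset hcover)).trans ?_
  have : W.ncard ≤ 2 * M * (k + 1) := hcard.trans (by nlinarith)
  exact_mod_cast this

end PlaneGraph

end Geometry

/-! ### Lattice-like graphs and the energy of a function -/

section LatticeLike

open Set Finset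

theorem SimpleGraph.edist_le_coe_iff {V : Type*} {G : SimpleGraph V} {u v : V} {n : ℕ} :
    G.edist u v ≤ n ↔ ∃ p : G.Walk u v, p.length ≤ n := by
  constructor
  · intro hle
    obtain ⟨p, hp⟩ := SimpleGraph.exists_walk_of_edist_ne_top
      (ne_top_of_le_ne_top (ENat.natCast_ne_top n) hle)
    refine ⟨p, ?_⟩
    rw [← hp] at hle
    exact_mod_cast hle
  · rintro ⟨p, hp⟩
    exact (SimpleGraph.edist_le p).trans (by exact_mod_cast hp)

/-- A graph that looks like the square lattice on a large scale.  The vertices are distributed over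
the cells of `ℤ × ℤ`, with a chosen vertex in each cell and at most `M` vertices per cell; edges
join vertices in equal or touching cells, and conversely the graph distance of two vertices is
bounded by `D` times the distance of their cells, up to an additive constant. -/
structure IsLatticeLike {V : Type*} (G : SimpleGraph V) (cell : V → ℤ × ℤ) (rep : ℤ × ℤ → V)
    (M D : ℕ) : Prop where
  cell_rep : ∀ p, cell (rep p) = p
  near_of_adj : ∀ u v, G.Adj u v → Near 1 (cell u) (cell v)
  finite_fiber : ∀ p, (cell ⁻¹' {p}).Finite
  ncard_fiber_le : ∀ p, (cell ⁻¹' {p}).ncard ≤ M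
  one_le : 1 ≤ D
  edist_le : ∀ u v k, Near k (cell u) (cell v) → G.edist u v ≤ ((D * (k + 1) : ℕ) : ℕ∞)

/-- The energy of `f` on a finite set of vertices with respect to the edge weights `ω`, each edge
being counted in both directions. -/
def energy {V : Type*} (ω : V → V → ℝ) (f : V → ℝ) (S : Finset V) : ℝ :=
  ∑ v ∈ S, ∑ w ∈ S, ω v w * (f w - f v) ^ 2

section Energy

variable {V : Type*} {G : SimpleGraph V} {ω : V → V → ℝ} {f : V → ℝ} {S : Finset V}

theorem energy_nonneg (hω : ∀ v w, 0 ≤ ω v w) : 0 ≤ energy ω f S :=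
  sum_nonneg fun v _ => sum_nonneg fun w _ => mul_nonneg (hω v w) (sq_nonneg _)

theorem term_le_energy (hω : ∀ v w, 0 ≤ ω v w) {v w : V} (hv : v ∈ S) (hw : w ∈ S) :
    ω v w * (f w - f v) ^ 2 ≤ energy ω f S := by
  have hnn : ∀ v w, 0 ≤ ω v w * (f w - f v) ^ 2 := fun v w => mul_nonneg (hω v w) (sq_nonneg _)
  refine le_trans ?_ (single_le_sum (fun v _ => sum_nonneg fun w _ => hnn v w) hv)
  exact single_le_sum (f := fun w => ω v w * (f w - f v) ^ 2) (fun w _ => hnn v w) hw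

theorem abs_sub_le_of_walk {ω₀ : ℝ} (h0 : 0 < ω₀) (hω : ∀ v w, 0 ≤ ω v w)
    (hω₀ : ∀ v w, G.Adj v w → ω₀ ≤ ω v w) {u v : V} (p : G.Walk u v)
    (hp : ∀ x ∈ p.support, x ∈ S) : |f u - f v| ≤ p.length * √(energy ω f S / ω₀) := by
  induction p with
  | nil => simp
  | @cons a b c hab q ih =>
    have h1 := ih fun x hx => hp x (by simp [hx])
    have h2 : |f a - f b| ≤ √(energy ω f S / ω₀) := by
      apply Real.abs_le_sqrt
      rw [le_div_iff₀ h0]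
      have h3 := term_le_energy (f := f) hω (hp b (by simp)) (hp a (by simp))
      nlinarith [hω₀ b a hab.symm, sq_nonneg (f a - f b)]
    have h3 := abs_sub_le (f a) (f b) (f c)
    rw [SimpleGraph.Walk.length_cons]
    push_cast
    linarith

/-- The difference of `f` at two vertices is controlled by the energy along a shortest path. -/
theorem sq_sub_le_energy {ω₀ : ℝ} (h0 : 0 < ω₀) (hω : ∀ v w, 0 ≤ ω v w)
    (hω₀ : ∀ v w, G.Adj v w → ω₀ ≤ ω v w) {u v : V} {k : ℕ} (huv : G.edist u v ≤ k)
    (hS : ∀ x, G.edist u x ≤ k → x ∈ S) : (f u - f v) ^ 2 ≤ k ^ 2 * (energy ω f S / ω₀) := by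
  classical
  obtain ⟨p, hp⟩ := SimpleGraph.edist_le_coe_iff.1 huv
  have h1 := abs_sub_le_of_walk (S := S) (f := f) h0 hω hω₀ p fun x hx =>
    hS x (SimpleGraph.edist_le_coe_iff.2
      ⟨p.takeUntil x hx, (p.length_takeUntil_le_length hx).trans hp⟩)
  have h2 : |f u - f v| ≤ k * √(energy ω f S / ω₀) := by
    refine h1.trans ?_
    gcongr
  calc (f u - f v) ^ 2 = |f u - f v| ^ 2 := (sq_abs _).symm
    _ ≤ (k * √(energy ω f S / ω₀)) ^ 2 := by gcongr
    _ = k ^ 2 * (energy ω f S / ω₀) := by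
      rw [mul_pow, Real.sq_sqrt (div_nonneg (energy_nonneg hω) h0.le)]

end Energy

/-! ### Functions on the square lattice -/

/-- The square of an average is at most the average of the squares. -/
theorem sq_average_le {ι : Type*} (s : Finset ι) (a : ι → ℝ) {b : ℝ} (hb : (s.card : ℝ) = b)
    (hb0 : 0 < b) : ((∑ i ∈ s, a i) / b) ^ 2 ≤ (∑ i ∈ s, a i ^ 2) / b := by
  have h1 := sq_sum_le_card_mul_sum_sq (s := s) (f := a)
  rw [hb] at h1
  rw [div_pow, div_le_div_iff₀ (by positivity) hb0]
  nlinarith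

/-- The translate of a function by `τ` differs from it in square mean by at most the length of `τ`
times the size of the gradient, here represented by a majorant `gr` of the squared differences of
neighboring values. -/
theorem sum_sq_translate_sub_le {F gr : ℤ × ℤ → ℝ} (hgr0 : ∀ q, 0 ≤ gr q)
    (hgr : ∀ q q', Near 1 q q' → (F q' - F q) ^ 2 ≤ gr q) {R R' : Finset (ℤ × ℤ)} {k : ℕ}
    {τ : ℤ × ℤ} (hτ : Near k 0 τ) (hR : ∀ p ∈ R, ∀ q, Near k p q → q ∈ R') :
    ∑ p ∈ R, (F (p + τ) - F p) ^ 2 ≤ k ^ 2 * ∑ q ∈ R', gr q := by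
  -- a path of `k` steps from `0` to `τ`
  obtain ⟨σ, hσ⟩ : ∃ σ : ℕ → ℤ × ℤ,
      σ = fun i : ℕ => (max (-(i : ℤ)) (min i τ.1), max (-(i : ℤ)) (min i τ.2)) := ⟨_, rfl⟩
  have hσ0 : σ 0 = 0 := by
    rw [hσ]
    ext <;> simp
  have hσk : σ k = τ := by
    unfold Near at hτ
    simp only [Prod.fst_zero, Prod.snd_zero] at hτ
    rw [hσ]
    ext <;> simp only <;> omega
  have hσstep : ∀ p i, Near 1 (p + σ i) (p + σ (i + 1)) := by
    intro p i
    unfold Near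
    rw [hσ]
    simp only [Prod.fst_add, Prod.snd_add]
    omega
  have hσnear : ∀ p, ∀ i ∈ range k, Near k p (p + σ i) := by
    intro p i hi
    rw [Finset.mem_range] at hi
    unfold Near
    rw [hσ]
    simp only [Prod.fst_add, Prod.snd_add]
    omega
  have hpt : ∀ p, (F (p + τ) - F p) ^ 2 ≤ k * ∑ i ∈ range k, gr (p + σ i) := by
    intro p
    have h1 : F (p + τ) - F p = ∑ i ∈ range k, (F (p + σ (i + 1)) - F (p + σ i)) := by
      rw [Finset.sum_range_sub (fun i => F (p + σ i)), hσ0, hσk, add_zero]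
    have h2 := sq_sum_le_card_mul_sum_sq (s := range k)
      (f := fun i => F (p + σ (i + 1)) - F (p + σ i))
    rw [h1]
    refine h2.trans ?_
    rw [card_range]
    gcongr with i _
    exact hgr _ _ (hσstep p i)
  calc ∑ p ∈ R, (F (p + τ) - F p) ^ 2 ≤ ∑ p ∈ R, k * ∑ i ∈ range k, gr (p + σ i) :=
        sum_le_sum fun p _ => hpt p
    _ = k * ∑ i ∈ range k, ∑ p ∈ R, gr (p + σ i) := by rw [← mul_sum, sum_comm]
    _ ≤ k * ∑ i ∈ range k, ∑ q ∈ R', gr q := by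
        gcongr with i hi
        have hmap : ∑ p ∈ R, gr (p + σ i) = ∑ q ∈ R.map (addRightEmbedding (σ i)), gr q := by
          rw [sum_map]
          rfl
        rw [hmap]
        refine sum_le_sum_of_subset_of_nonneg ?_ fun q _ _ => hgr0 q
        intro q hq
        obtain ⟨p, hp, rfl⟩ := Finset.mem_map.1 hq
        exact hR p hp _ (hσnear p i hi)
    _ = k ^ 2 * ∑ q ∈ R', gr q := by
        rw [sum_const, card_range, nsmul_eq_mul]
        ring

/-- The average of `F` over the box of radius `N` around `p`. -/
noncomputable def boxAverage (F : ℤ × ℤ → ℝ) (N : ℕ) (p : ℤ × ℤ) : ℝ :=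
  (∑ τ ∈ squareBox 0 N, F (p + τ)) / (2 * N + 1) ^ 2

theorem card_squareBox_cast (p : ℤ × ℤ) (N : ℕ) : ((squareBox p N).card : ℝ) = (2 * N + 1) ^ 2 := by
  rw [card_squareBox]
  push_cast
  ring

section Lattice

variable {F gr : ℤ × ℤ → ℝ} {R R' : Finset (ℤ × ℤ)} {N : ℕ}

theorem sum_sq_sub_boxAverage_le (hgr0 : ∀ q, 0 ≤ gr q)
    (hgr : ∀ q q', Near 1 q q' → (F q' - F q) ^ 2 ≤ gr q)
    (hR : ∀ p ∈ R, ∀ q, Near N p q → q ∈ R') :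
    ∑ p ∈ R, (F p - boxAverage F N p) ^ 2 ≤ N ^ 2 * ∑ q ∈ R', gr q := by
  have hb0 : (0 : ℝ) < (2 * N + 1) ^ 2 := by positivity
  have hpt : ∀ p, (F p - boxAverage F N p) ^ 2 ≤
      (∑ τ ∈ squareBox 0 N, (F (p + τ) - F p) ^ 2) / (2 * N + 1) ^ 2 := by
    intro p
    have h1 := sq_average_le (squareBox 0 N) (fun τ => F (p + τ) - F p)
      (card_squareBox_cast 0 N) hb0
    rw [sum_sub_distrib, sum_const, nsmul_eq_mul, card_squareBox_cast, sub_div,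
      mul_div_cancel_left₀ _ hb0.ne'] at h1
    rw [← neg_sq, neg_sub]
    exact h1
  calc ∑ p ∈ R, (F p - boxAverage F N p) ^ 2
      ≤ ∑ p ∈ R, (∑ τ ∈ squareBox 0 N, (F (p + τ) - F p) ^ 2) / (2 * N + 1) ^ 2 :=
        sum_le_sum fun p _ => hpt p
    _ = (∑ τ ∈ squareBox 0 N, ∑ p ∈ R, (F (p + τ) - F p) ^ 2) / (2 * N + 1) ^ 2 := by
        rw [← sum_div, sum_comm]
    _ ≤ (∑ τ ∈ squareBox 0 N, N ^ 2 * ∑ q ∈ R', gr q) / (2 * N + 1) ^ 2 := by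
        gcongr with τ hτ
        exact sum_sq_translate_sub_le hgr0 hgr (mem_squareBox.1 hτ) hR
    _ = N ^ 2 * ∑ q ∈ R', gr q := by
        rw [sum_const, nsmul_eq_mul, card_squareBox_cast, mul_div_cancel_left₀ _ hb0.ne']

/-- The averages over two overlapping boxes of comparable size differ by at most the root of the
gradient energy: this is where dimension two enters. -/
theorem sq_boxAverage_sub_le (hgr0 : ∀ q, 0 ≤ gr q)
    (hgr : ∀ q q', Near 1 q q' → (F q' - F q) ^ 2 ≤ gr q) {p p' : ℤ × ℤ} (hp : Near N p p')
    (hR : ∀ q, Near (2 * N) p q → q ∈ R') :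
    (boxAverage F N p' - boxAverage F N p) ^ 2 ≤ ∑ q ∈ R', gr q := by
  have hb0 : (0 : ℝ) < (2 * N + 1) ^ 2 := by positivity
  have h1 := sq_average_le (squareBox 0 N) (fun τ => F (p + τ + (p' - p)) - F (p + τ))
    (card_squareBox_cast 0 N) hb0
  have h2 : ∀ τ, p + τ + (p' - p) = p' + τ := fun τ => by abel
  have h3 : ∑ τ ∈ squareBox 0 N, (F (p + τ + (p' - p)) - F (p + τ)) ^ 2 ≤
      N ^ 2 * ∑ q ∈ R', gr q := by
    have h4 := sum_sq_translate_sub_le (R := (squareBox 0 N).map (addLeftEmbedding p)) (R' := R')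
      (k := N) (τ := p' - p) hgr0 hgr ?_ ?_
    · rwa [sum_map] at h4
    · unfold Near at *
      simp only [Prod.fst_zero, Prod.snd_zero, Prod.fst_sub, Prod.snd_sub]
      omega
    · intro q hq q' hq'
      obtain ⟨τ, hτ, rfl⟩ := Finset.mem_map.1 hq
      rw [mem_squareBox] at hτ
      apply hR
      unfold Near at *
      simp only [addLeftEmbedding_apply, Prod.fst_add, Prod.snd_add, Prod.fst_zero,
        Prod.snd_zero] at *
      push_cast
      omega
  simp only [h2] at h1 h3
  rw [sum_sub_distrib, sub_div] at h1
  refine h1.trans ?_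
  rw [div_le_iff₀ hb0]
  refine h3.trans ?_
  have h5 : 0 ≤ ∑ q ∈ R', gr q := sum_nonneg fun q _ => hgr0 q
  rw [mul_comm]
  gcongr
  have : (0 : ℝ) ≤ N := N.cast_nonneg
  linarith

end Lattice

/-! ### Volume growth and Poincaré inequality for lattice-like graphs -/

namespace IsLatticeLike

variable {V : Type*} {G : SimpleGraph V} {cell : V → ℤ × ℤ} {rep : ℤ × ℤ → V} {M D : ℕ}

theorem near_of_edist_le (H : IsLatticeLike G cell rep M D) {u v : V} {n : ℕ}
    (huv : G.edist u v ≤ n) : Near n (cell u) (cell v) := by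
  obtain ⟨p, hp⟩ := SimpleGraph.edist_le_coe_iff.1 huv
  have key : Near p.length (cell u) (cell v) := by
    clear hp huv
    induction p with
    | nil => exact Near.refl _ _
    | cons hab q ih =>
      exact (H.near_of_adj _ _ hab).trans ih (by rw [SimpleGraph.Walk.length_cons, add_comm])
  exact key.trans (Near.refl 0 _) (by simpa using hp)

theorem finite_preimage (H : IsLatticeLike G cell rep M D) (R : Finset (ℤ × ℤ)) :
    (cell ⁻¹' R).Finite :=
  R.finite_toSet.preimage' fun p _ => H.finite_fiber p

theorem ncard_preimage_le (H : IsLatticeLike G cell rep M D) (R : Finset (ℤ × ℤ)) :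
    (cell ⁻¹' R).ncard ≤ R.card * M := by
  have h1 : cell ⁻¹' R = ⋃ p ∈ R, cell ⁻¹' {p} := by
    ext v
    simp
  rw [h1]
  refine (Finset.set_ncard_biUnion_le _ _).trans ?_
  exact (sum_le_card_nsmul _ _ M fun p _ => H.ncard_fiber_le p).trans (by rw [smul_eq_mul])

theorem ball_subset (H : IsLatticeLike G cell rep M D) (u : V) (n : ℕ) :
    {v | G.edist v u ≤ n} ⊆ cell ⁻¹' (squareBox (cell u) n : Finset (ℤ × ℤ)) := fun v hv => by
  rw [Set.mem_preimage, Finset.mem_coe, mem_squareBox]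
  exact (H.near_of_edist_le hv).symm

theorem finite_ball (H : IsLatticeLike G cell rep M D) (u : V) (n : ℕ) :
    {v | G.edist v u ≤ n}.Finite :=
  (H.finite_preimage _).subset (H.ball_subset u n)

theorem ncard_ball_le (H : IsLatticeLike G cell rep M D) (u : V) (n : ℕ) :
    {v | G.edist v u ≤ n}.ncard ≤ (2 * n + 1) ^ 2 * M := by
  rw [← card_squareBox (cell u)]
  exact (ncard_le_ncard (H.ball_subset u n) (H.finite_preimage _)).trans (H.ncard_preimage_le _)

theorem le_ncard_ball (H : IsLatticeLike G cell rep M D) (u : V) {n : ℕ} (hn : 1 ≤ n) :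
    (n : ℝ) ^ 2 / (4 * D ^ 2) ≤ ({v | G.edist v u ≤ n}.ncard : ℝ) := by
  have hD := H.one_le
  have hD' : (1 : ℝ) ≤ D := by exact_mod_cast hD
  rw [div_le_iff₀ (by positivity)]
  rcases lt_or_ge n D with hlt | hge
  · have h1 : 1 ≤ {v | G.edist v u ≤ n}.ncard := by
      rw [Nat.one_le_iff_ne_zero, Ne, ncard_eq_zero (H.finite_ball u n)]
      exact Set.Nonempty.ne_empty ⟨u, by simp⟩
    have h1 : (1 : ℝ) ≤ ({v | G.edist v u ≤ n}.ncard : ℝ) := by exact_mod_cast h1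
    have h2 : (n : ℝ) < D := by exact_mod_cast hlt
    have h3 : (n : ℝ) ^ 2 ≤ D ^ 2 := by gcongr
    nlinarith
  · obtain ⟨k, hk⟩ : ∃ k, n / D = k + 1 :=
      Nat.exists_eq_add_of_le' ((Nat.one_le_div_iff (by omega)).2 hge)
    have h1 : D * (k + 1) ≤ n := hk ▸ Nat.mul_div_le n D
    have h2 : n < D * (k + 1 + 1) := hk ▸ Nat.lt_mul_div_succ n (by omega)
    have h3 : (2 * k + 1) ^ 2 ≤ {v | G.edist v u ≤ n}.ncard := by
      rw [← card_squareBox (cell u), ← ncard_coe_finset]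
      refine ncard_le_ncard_of_injOn rep ?_ ?_ (H.finite_ball u n)
      · intro p hp
        rw [Finset.mem_coe, mem_squareBox] at hp
        refine (H.edist_le (rep p) u k ?_).trans (by exact_mod_cast h1)
        rw [H.cell_rep]
        exact hp.symm
      · intro p _ q _ hpq
        rw [← H.cell_rep p, hpq, H.cell_rep]
    have h4 : n ≤ 2 * D * (2 * k + 1) := by nlinarith
    have h5 : n ^ 2 ≤ {v | G.edist v u ≤ n}.ncard * (4 * D ^ 2) := by
      calc n ^ 2 ≤ (2 * D * (2 * k + 1)) ^ 2 := by gcongr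
        _ = (2 * k + 1) ^ 2 * (4 * D ^ 2) := by ring
        _ ≤ _ := by gcongr
    exact_mod_cast h5

/-- The vertices in the cells at distance at most `2 D` from `q`. -/
noncomputable def nearVerts (H : IsLatticeLike G cell rep M D) (q : ℤ × ℤ) : Finset V :=
  (H.finite_preimage (squareBox q (2 * D))).toFinset

theorem mem_nearVerts (H : IsLatticeLike G cell rep M D) {q : ℤ × ℤ} {v : V} :
    v ∈ H.nearVerts q ↔ Near (2 * D) q (cell v) := by
  unfold nearVerts
  rw [Set.Finite.mem_toFinset, Set.mem_preimage, Finset.mem_coe, mem_squareBox]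

section Energy

variable {ω : V → V → ℝ} {ω₀ : ℝ}

/-- Neighboring representatives are joined by a path of length at most `2 D`. -/
theorem sq_rep_sub_le (H : IsLatticeLike G cell rep M D) (h0 : 0 < ω₀) (hω : ∀ v w, 0 ≤ ω v w)
    (hω₀ : ∀ v w, G.Adj v w → ω₀ ≤ ω v w) (f : V → ℝ) {q q' : ℤ × ℤ} (hq : Near 1 q q') :
    (f (rep q') - f (rep q)) ^ 2 ≤ (2 * D) ^ 2 / ω₀ * energy ω f (H.nearVerts q) := by
  have h1 : G.edist (rep q) (rep q') ≤ ((2 * D : ℕ) : ℕ∞) := by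
    have := H.edist_le (rep q) (rep q') 1 (by rwa [H.cell_rep, H.cell_rep])
    rwa [show D * (1 + 1) = 2 * D by ring] at this
  have h2 := sq_sub_le_energy (f := f) (S := H.nearVerts q) h0 hω hω₀ h1 fun x hx => by
    rw [H.mem_nearVerts]
    simpa only [H.cell_rep] using H.near_of_edist_le hx
  rw [← neg_sq, neg_sub]
  refine h2.trans_eq ?_
  push_cast
  ring

/-- The local energies add up to at most a multiple of the total energy, since each vertex is near
boundedly many cells. -/
theorem sum_energy_le (H : IsLatticeLike G cell rep M D) (hω : ∀ v w, 0 ≤ ω v w) (f : V → ℝ)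
    {R : Finset (ℤ × ℤ)} {S : Finset V} (hS : ∀ q ∈ R, ∀ x, Near (2 * D) q (cell x) → x ∈ S) :
    ∑ q ∈ R, energy ω f (H.nearVerts q) ≤ (4 * D + 1) ^ 2 * energy ω f S := by
  classical
  have hnn : ∀ v w, 0 ≤ ω v w * (f w - f v) ^ 2 := fun v w => mul_nonneg (hω v w) (sq_nonneg _)
  have h1 : ∀ q ∈ R, energy ω f (H.nearVerts q) ≤
      ∑ v ∈ S, if Near (2 * D) q (cell v) then ∑ w ∈ S, ω v w * (f w - f v) ^ 2 else 0 := by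
    intro q hq
    have hsub : H.nearVerts q ⊆ S := fun x hx => hS q hq x (H.mem_nearVerts.1 hx)
    rw [← sum_filter]
    unfold energy
    calc _ ≤ ∑ v ∈ H.nearVerts q, ∑ w ∈ S, ω v w * (f w - f v) ^ 2 :=
          sum_le_sum fun v _ => sum_le_sum_of_subset_of_nonneg hsub fun w _ _ => hnn v w
      _ ≤ _ := by
          refine sum_le_sum_of_subset_of_nonneg ?_ fun v _ _ => sum_nonneg fun w _ => hnn v w
          intro v hv
          exact Finset.mem_filter.2 ⟨hsub hv, H.mem_nearVerts.1 hv⟩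
  refine (sum_le_sum h1).trans ?_
  rw [sum_comm]
  unfold energy
  rw [mul_sum]
  refine sum_le_sum fun v _ => ?_
  rw [← sum_filter, sum_const, nsmul_eq_mul]
  refine mul_le_mul_of_nonneg_right ?_ (sum_nonneg fun w _ => hnn v w)
  have h2 : (R.filter fun q => Near (2 * D) q (cell v)) ⊆ squareBox (cell v) (2 * D) := by
    intro q hq
    exact mem_squareBox.2 (Finset.mem_filter.1 hq).2.symm
  have h3 := Finset.card_le_card h2
  rw [card_squareBox] at h3
  calc _ ≤ (((2 * (2 * D) + 1) ^ 2 : ℕ) : ℝ) := by exact_mod_cast h3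
    _ = _ := by
      push_cast
      ring

end Energy

/-- Along a shortest path from `u` the box averages vary slowly. -/
theorem abs_boxAverage_sub_le (H : IsLatticeLike G cell rep M D) {F gr : ℤ × ℤ → ℝ}
    (hgr0 : ∀ q, 0 ≤ gr q) (hgr : ∀ q q', Near 1 q q' → (F q' - F q) ^ 2 ≤ gr q)
    {R : Finset (ℤ × ℤ)} {N n : ℕ} {u : V}
    (hR : ∀ v, G.edist v u ≤ n → ∀ q, Near (2 * N) (cell v) q → q ∈ R) (j : ℕ) :
    ∀ v, G.edist v u ≤ n → G.edist v u ≤ ((j * N : ℕ) : ℕ∞) →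
      |boxAverage F N (cell v) - boxAverage F N (cell u)| ≤ j * √(∑ q ∈ R, gr q) := by
  induction j with
  | zero =>
    intro v _ hv
    simp only [zero_mul, Nat.cast_zero, nonpos_iff_eq_zero, SimpleGraph.edist_eq_zero_iff] at hv
    simp [hv]
  | succ j ih =>
    intro v hvn hvj
    obtain ⟨p, hp⟩ := SimpleGraph.edist_le_coe_iff.1 (le_min hvn hvj)
    obtain ⟨hp1, hp2⟩ := le_min_iff.1 hp
    have h1 : G.edist v (p.getVert N) ≤ N :=
      SimpleGraph.edist_le_coe_iff.2 ⟨p.take N, by rw [SimpleGraph.Walk.take_length]; omega⟩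
    have h2 : (p.drop N).length ≤ min n (j * N) := by
      rw [SimpleGraph.Walk.drop_length]
      rw [Nat.succ_mul] at hp2
      omega
    have h3 : G.edist (p.getVert N) u ≤ n :=
      SimpleGraph.edist_le_coe_iff.2 ⟨p.drop N, h2.trans (min_le_left _ _)⟩
    have h4 : G.edist (p.getVert N) u ≤ ((j * N : ℕ) : ℕ∞) :=
      SimpleGraph.edist_le_coe_iff.2 ⟨p.drop N, h2.trans (min_le_right _ _)⟩
    have h5 := ih _ h3 h4
    have h6 := Real.abs_le_sqrt (sq_boxAverage_sub_le hgr0 hgr (H.near_of_edist_le h1) (hR v hvn))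
    rw [abs_sub_comm] at h6
    have h7 := abs_sub_le (boxAverage F N (cell v)) (boxAverage F N (cell (p.getVert N)))
      (boxAverage F N (cell u))
    push_cast
    linarith

end IsLatticeLike

end LatticeLike

section Poincare

open Finset

/-- The weighted mean minimizes the weighted sum of squared deviations. -/
theorem sum_mul_sq_sub_mean_le {ι : Type*} (s : Finset ι) (m f : ι → ℝ) (hW : 0 < ∑ i ∈ s, m i)
    (a : ℝ) : ∑ i ∈ s, m i * (f i - 1 / (∑ i ∈ s, m i) * ∑ i ∈ s, m i * f i) ^ 2 ≤
      ∑ i ∈ s, m i * (f i - a) ^ 2 := by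
  set W := ∑ i ∈ s, m i with hWdef
  set μ := 1 / W * ∑ i ∈ s, m i * f i with hμ
  have h1 : ∑ i ∈ s, m i * f i = W * μ := by
    rw [hμ]
    field_simp
  have h2 : ∑ i ∈ s, m i * (f i - a) ^ 2 - ∑ i ∈ s, m i * (f i - μ) ^ 2 =
      2 * (μ - a) * (W * μ) - (μ - a) * (μ + a) * W := by
    rw [← h1, hWdef, mul_sum, mul_sum, ← sum_sub_distrib, ← sum_sub_distrib]
    exact sum_congr rfl fun i _ => by ring
  have h3 : 2 * (μ - a) * (W * μ) - (μ - a) * (μ + a) * W = W * (μ - a) ^ 2 := by ring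
  have h4 : 0 ≤ W * (μ - a) ^ 2 := by positivity
  linarith

theorem IsLatticeLike.sum_comp_cell_le {V : Type*} {G : SimpleGraph V} {cell : V → ℤ × ℤ}
    {rep : ℤ × ℤ → V} {M D : ℕ} (H : IsLatticeLike G cell rep M D) (B : Finset V)
    {a : ℤ × ℤ → ℝ} (ha : ∀ p, 0 ≤ a p) :
    ∑ v ∈ B, a (cell v) ≤ M * ∑ p ∈ B.image cell, a p := by
  rw [sum_comp, mul_sum]
  refine sum_le_sum fun p _ => ?_
  rw [nsmul_eq_mul]
  refine mul_le_mul_of_nonneg_right ?_ (ha p)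
  have h1 : #{v ∈ B | cell v = p} ≤ M := by
    rw [← Set.ncard_coe_finset]
    refine (Set.ncard_le_ncard ?_ (H.finite_fiber p)).trans (H.ncard_fiber_le p)
    intro v hv
    exact (Finset.mem_filter.1 hv).2
  exact_mod_cast h1

/-- The Poincaré inequality on balls of radius `n` that are large compared to `D`, with respect to
the average of `f ∘ rep` over a box of radius `N = n / (4 D)` around the center.  All boxes of
this size around points of the ball are contained in the ball of twice the radius. -/
theorem IsLatticeLike.poincare_of_large {V : Type*} {G : SimpleGraph V} {cell : V → ℤ × ℤ}
    {rep : ℤ × ℤ → V} {M D : ℕ} (H : IsLatticeLike G cell rep M D) {ω : V → V → ℝ} {ω₀ : ℝ}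
    (h0 : 0 < ω₀) (hω : ∀ v w, 0 ≤ ω v w) (hω₀ : ∀ v w, G.Adj v w → ω₀ ≤ ω v w) (f : V → ℝ)
    (u : V) {n : ℕ} (hn : 4 * D ^ 2 + 2 * D ≤ n) {B S : Finset V}
    (hB : ∀ v, v ∈ B ↔ G.edist v u ≤ n) (hS : ∀ v, v ∈ S ↔ G.edist v u ≤ ((2 * n : ℕ) : ℕ∞))
    (hcard : (#B : ℝ) ≤ 9 * M * n ^ 2) :
    ∃ a : ℝ, ∑ v ∈ B, (f v - a) ^ 2 ≤ 3 * (9 * M * D ^ 2 / ω₀ +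
      (M + 9 * M * (8 * D) ^ 2) * ((2 * D) ^ 2 / ω₀ * (4 * D + 1) ^ 2)) * n ^ 2 *
        energy ω f S := by
  classical
  have hD := H.one_le
  obtain ⟨N, hN⟩ : ∃ N, N = n / (4 * D) := ⟨_, rfl⟩
  have hN1 : 4 * D * N ≤ n := hN ▸ Nat.mul_div_le n (4 * D)
  have hN2 : n < 4 * D * (N + 1) := hN ▸ Nat.lt_mul_div_succ n (by omega)
  have hN3 : n ≤ 8 * D * N := by
    have : 4 * D ≤ 4 * D * N := by
      have h1 : 1 ≤ N := by
        by_contra! h2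
        obtain rfl : N = 0 := by omega
        nlinarith
      nlinarith
    nlinarith
  have hNn : N ≤ n := by nlinarith
  obtain ⟨F, hF⟩ : ∃ F : ℤ × ℤ → ℝ, F = fun p => f (rep p) := ⟨_, rfl⟩
  obtain ⟨gr, hgr⟩ : ∃ gr : ℤ × ℤ → ℝ,
      gr = fun q => (2 * D) ^ 2 / ω₀ * energy ω f (H.nearVerts q) := ⟨_, rfl⟩
  have hgr0 : ∀ q, 0 ≤ gr q := fun q => by
    rw [hgr]
    have := energy_nonneg (f := f) (S := H.nearVerts q) hω
    positivity
  have hgrF : ∀ q q', Near 1 q q' → (F q' - F q) ^ 2 ≤ gr q := fun q q' hq => by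
    rw [hgr, hF]
    exact H.sq_rep_sub_le h0 hω hω₀ f hq
  obtain ⟨R', hR'⟩ : ∃ R' : Finset (ℤ × ℤ),
      R' = (B.image cell).biUnion fun p => squareBox p (2 * N) := ⟨_, rfl⟩
  have hRmem : ∀ p ∈ B.image cell, ∀ q, Near (2 * N) p q → q ∈ R' := by
    intro p hp q hq
    rw [hR']
    exact mem_biUnion.2 ⟨p, hp, mem_squareBox.2 hq⟩
  have hRS : ∀ q ∈ R', ∀ x, Near (2 * D) q (cell x) → x ∈ S := by
    intro q hq x hx
    rw [hR', mem_biUnion] at hq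
    obtain ⟨p, hp, hq⟩ := hq
    obtain ⟨v, hv, rfl⟩ := mem_image.1 hp
    have h1 := H.edist_le x v (2 * N + 2 * D) (((mem_squareBox.1 hq).trans hx le_rfl).symm)
    have h2 : D * (2 * N + 2 * D + 1) ≤ n := by nlinarith
    rw [hS]
    calc G.edist x u ≤ G.edist x v + G.edist v u := SimpleGraph.edist_triangle
      _ ≤ (n : ℕ∞) + n := add_le_add (h1.trans (by exact_mod_cast h2)) ((hB v).1 hv)
      _ = ((2 * n : ℕ) : ℕ∞) := by
        rw [two_mul]
        push_cast
        rfl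
  obtain ⟨E, hE⟩ : ∃ E, E = energy ω f S := ⟨_, rfl⟩
  obtain ⟨𝓔, h𝓔⟩ : ∃ 𝓔, 𝓔 = ∑ q ∈ R', gr q := ⟨_, rfl⟩
  have hE0 : 0 ≤ E := hE ▸ energy_nonneg hω
  have h𝓔0 : 0 ≤ 𝓔 := h𝓔 ▸ sum_nonneg fun q _ => hgr0 q
  have h𝓔E : 𝓔 ≤ (2 * D) ^ 2 / ω₀ * (4 * D + 1) ^ 2 * E := by
    rw [h𝓔, hgr, ← mul_sum, mul_assoc, hE]
    gcongr
    exact H.sum_energy_le hω f hRS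
  -- distance of `f` to its value at the representative of the cell
  have hT1 : ∀ v ∈ B, (f v - F (cell v)) ^ 2 ≤ D ^ 2 * (E / ω₀) := by
    intro v hv
    rw [hF, hE]
    refine sq_sub_le_energy (S := S) h0 hω hω₀ ?_ fun x hx => ?_
    · have h1 := H.edist_le v (rep (cell v)) 0 (by rw [H.cell_rep]; exact Near.refl _ _)
      simpa using h1
    · rw [hS]
      rw [SimpleGraph.edist_comm] at hx
      calc G.edist x u ≤ G.edist x v + G.edist v u := SimpleGraph.edist_triangle
        _ ≤ (D : ℕ∞) + n := add_le_add hx ((hB v).1 hv)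
        _ ≤ ((2 * n : ℕ) : ℕ∞) := by
          have h2 : D + n ≤ 2 * n := by nlinarith
          exact_mod_cast h2
  -- distance of the value in a cell to the average over a box around the cell
  have hT2 : ∑ v ∈ B, (F (cell v) - boxAverage F N (cell v)) ^ 2 ≤ M * (n ^ 2 * 𝓔) := by
    refine (H.sum_comp_cell_le B (a := fun p => (F p - boxAverage F N p) ^ 2)
      fun p => sq_nonneg _).trans ?_
    gcongr
    refine (sum_sq_sub_boxAverage_le (R' := R') hgr0 hgrF fun p hp q hq =>
      hRmem p hp q (hq.trans (Near.refl 0 _) (by omega))).trans ?_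
    rw [← h𝓔]
    gcongr
  -- distance of that average to the one around the center
  have hT3 : ∀ v ∈ B, (boxAverage F N (cell v) - boxAverage F N (cell u)) ^ 2 ≤
      (8 * D) ^ 2 * 𝓔 := by
    intro v hv
    have h1 := H.abs_boxAverage_sub_le (R := R') (N := N) (n := n) (u := u) hgr0 hgrF
      (fun w hw => hRmem _ (mem_image_of_mem _ ((hB w).2 hw))) (8 * D) v ((hB v).1 hv)
      (((hB v).1 hv).trans (by exact_mod_cast hN3))
    rw [← h𝓔] at h1
    rw [← sq_abs]
    refine (pow_le_pow_left₀ (abs_nonneg _) h1 2).trans_eq ?_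
    rw [mul_pow, Real.sq_sqrt h𝓔0]
    push_cast
    ring
  have h3 : ∀ v ∈ B, (f v - boxAverage F N (cell u)) ^ 2 ≤ 3 * (D ^ 2 * (E / ω₀) +
      (F (cell v) - boxAverage F N (cell v)) ^ 2 + (8 * D) ^ 2 * 𝓔) := by
    intro v hv
    nlinarith [hT1 v hv, hT3 v hv,
      sq_nonneg ((f v - F (cell v)) - (F (cell v) - boxAverage F N (cell v))),
      sq_nonneg ((f v - F (cell v)) - (boxAverage F N (cell v) - boxAverage F N (cell u))),
      sq_nonneg ((F (cell v) - boxAverage F N (cell v)) -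
        (boxAverage F N (cell v) - boxAverage F N (cell u)))]
  refine ⟨boxAverage F N (cell u), ?_⟩
  rw [← hE]
  calc ∑ v ∈ B, (f v - boxAverage F N (cell u)) ^ 2
      ≤ 3 * (#B * (D ^ 2 * (E / ω₀)) + ∑ v ∈ B, (F (cell v) - boxAverage F N (cell v)) ^ 2 +
        #B * ((8 * D) ^ 2 * 𝓔)) := by
        refine (sum_le_sum h3).trans_eq ?_
        rw [← mul_sum, sum_add_distrib, sum_add_distrib, sum_const, sum_const, nsmul_eq_mul,
          nsmul_eq_mul]
    _ ≤ 3 * (9 * M * n ^ 2 * (D ^ 2 * (E / ω₀)) + M * (n ^ 2 * 𝓔) +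
        9 * M * n ^ 2 * ((8 * D) ^ 2 * 𝓔)) := by gcongr
    _ = 3 * (9 * M * D ^ 2 / ω₀ * E + (M + 9 * M * (8 * D) ^ 2) * 𝓔) * n ^ 2 := by ring
    _ ≤ 3 * (9 * M * D ^ 2 / ω₀ * E + (M + 9 * M * (8 * D) ^ 2) *
        ((2 * D) ^ 2 / ω₀ * (4 * D + 1) ^ 2 * E)) * n ^ 2 := by gcongr
    _ = _ := by ring

/-- The Poincaré inequality for balls in lattice-like graphs, with an unspecified constant `a` in
place of the mean and without vertex weights. -/
theorem exists_poincare_constant (M D : ℕ) {ω₀ : ℝ} (h0 : 0 < ω₀) : ∃ C : ℝ, 0 < C ∧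
    ∀ (V : Type) (G : SimpleGraph V) (cell : V → ℤ × ℤ) (rep : ℤ × ℤ → V)
      (_ : IsLatticeLike G cell rep M D) (ω : V → V → ℝ) (_ : ∀ v w, 0 ≤ ω v w)
      (_ : ∀ v w, G.Adj v w → ω₀ ≤ ω v w) (f : V → ℝ) (u : V) (n : ℕ) (_ : 1 ≤ n)
      (B S : Finset V) (_ : ∀ v, v ∈ B ↔ G.edist v u ≤ n)
      (_ : ∀ v, v ∈ S ↔ G.edist v u ≤ ((2 * n : ℕ) : ℕ∞)),
      ∃ a : ℝ, ∑ v ∈ B, (f v - a) ^ 2 ≤ C * n ^ 2 * energy ω f S := by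
  obtain ⟨C₁, hC₁⟩ : ∃ C₁ : ℝ, C₁ = 9 * M * (4 * D ^ 2 + 2 * D) ^ 2 / ω₀ := ⟨_, rfl⟩
  obtain ⟨C₂, hC₂⟩ : ∃ C₂ : ℝ, C₂ = 3 * (9 * M * D ^ 2 / ω₀ +
      (M + 9 * M * (8 * D) ^ 2) * ((2 * D) ^ 2 / ω₀ * (4 * D + 1) ^ 2)) := ⟨_, rfl⟩
  have hC₁0 : 0 ≤ C₁ := by rw [hC₁]; positivity
  have hC₂0 : 0 ≤ C₂ := by rw [hC₂]; positivity
  refine ⟨C₁ + C₂ + 1, by positivity, ?_⟩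
  intro V G cell rep H ω hω hω₀ f u n hn B S hB hS
  have hE0 : 0 ≤ energy ω f S := energy_nonneg hω
  have hn' : (1 : ℝ) ≤ n := by exact_mod_cast hn
  have hcard : (#B : ℝ) ≤ 9 * M * n ^ 2 := by
    have h1 : (B : Set V) = {v | G.edist v u ≤ n} := by
      ext v
      exact hB v
    have h2 := H.ncard_ball_le u n
    rw [← h1, Set.ncard_coe_finset] at h2
    calc (#B : ℝ) ≤ (((2 * n + 1) ^ 2 * M : ℕ) : ℝ) := by exact_mod_cast h2
      _ = (2 * n + 1) ^ 2 * M := by push_cast; ring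
      _ ≤ (3 * n) ^ 2 * M := by
        gcongr
        linarith
      _ = 9 * M * n ^ 2 := by ring
  rcases lt_or_ge n (4 * D ^ 2 + 2 * D) with hlt | hge
  · -- on balls of bounded radius the trivial bound along shortest paths suffices
    refine ⟨f u, ?_⟩
    have h1 : ∀ v ∈ B, (f v - f u) ^ 2 ≤ n ^ 2 * (energy ω f S / ω₀) := by
      intro v hv
      rw [← neg_sq, neg_sub]
      refine sq_sub_le_energy h0 hω hω₀ (by rw [SimpleGraph.edist_comm]; exact (hB v).1 hv)
        fun x hx => ?_
      rw [hS]
      rw [SimpleGraph.edist_comm] at hx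
      exact hx.trans (by exact_mod_cast (by omega : n ≤ 2 * n))
    have h2 : (n : ℝ) ≤ 4 * D ^ 2 + 2 * D := by exact_mod_cast hlt.le
    calc ∑ v ∈ B, (f v - f u) ^ 2 ≤ #B * (n ^ 2 * (energy ω f S / ω₀)) := by
          refine (sum_le_sum h1).trans_eq ?_
          rw [sum_const, nsmul_eq_mul]
      _ ≤ 9 * M * (4 * D ^ 2 + 2 * D) ^ 2 * (n ^ 2 * (energy ω f S / ω₀)) := by
          gcongr
          exact hcard.trans (by gcongr)
      _ = C₁ * n ^ 2 * energy ω f S := by rw [hC₁]; ring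
      _ ≤ (C₁ + C₂ + 1) * n ^ 2 * energy ω f S := by
          gcongr
          linarith
  · obtain ⟨a, ha⟩ := H.poincare_of_large h0 hω hω₀ f u hge hB hS hcard
    refine ⟨a, ha.trans ?_⟩
    rw [← hC₂]
    gcongr
    linarith

end Poincare

/-! ### Isoradial graphs are lattice-like -/

namespace PlaneGraph

open Set Metric

variable {Γ : PlaneGraph} {h : ℝ}

theorem IsIsoradial.exists_vertex_near (H : Γ.IsIsoradial h) (z : ℂ) :
    ∃ v : Γ.V, dist (v : ℂ) z ≤ h := by
  obtain ⟨f, hf, hz⟩ := H.exists_mem_closure_face z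
  obtain ⟨v, hv, -⟩ := (H f hf).exists_corner_ne 0 0
  exact ⟨⟨v, hv.1⟩, (H f hf).dist_le (frontier_subset_closure hv.2) hz⟩

theorem IsIsoradial.exists_adj (H : Γ.IsIsoradial h) (u : Γ.V) : ∃ v, Γ.graph.Adj u v := by
  obtain ⟨f, hf, hu⟩ := H.exists_mem_closure_face u
  obtain ⟨w, hw, hwu, -⟩ := (H f hf).exists_corner_ne u u
  obtain ⟨a, b, -, -, ha, -, hab⟩ := exists_adj_of_corners_split hf (H f hf) (T := {u})
    (w := ⟨w, hw.1⟩) (mem_corners_of_mem_closure hf u.2 hu) hw rfl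
    (fun h0 => hwu (congrArg Subtype.val h0))
  rw [mem_singleton_iff] at ha
  exact ⟨b, ha ▸ hab⟩

/-- The cells are the squares of a grid of mesh `3 h`.  The disc of radius `h` about the center of
a cell lies inside the cell and contains a vertex. -/
theorem exists_isLatticeLike {κ : ℝ} (hκ : 0 < κ) : ∃ M D : ℕ, ∀ (Γ : PlaneGraph) (h : ℝ),
    0 < h → Γ.IsIsoradial h → (∀ u v : Γ.V, Γ.graph.Adj u v → κ * h ≤ dist (u : ℂ) v) →
    ∃ cell rep, IsLatticeLike Γ.graph cell rep M D := by
  obtain ⟨M, hM⟩ := exists_card_bound hκ 6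
  obtain ⟨D, hD⟩ := exists_edist_bound hκ
  refine ⟨M, 7 * D + 1, fun Γ h hh H hs => ?_⟩
  have h3 : 0 < 3 * h := by positivity
  have hrep : ∀ p : ℤ × ℤ, ∃ v : Γ.V, gridCell (3 * h) v = p := by
    intro p
    obtain ⟨v, hv⟩ := H.exists_vertex_near ⟨(p.1 + 1 / 2) * (3 * h), (p.2 + 1 / 2) * (3 * h)⟩
    have hre := (Complex.abs_re_le_norm _).trans ((Complex.dist_eq _ _).symm.trans_le hv)
    have him := (Complex.abs_im_le_norm _).trans ((Complex.dist_eq _ _).symm.trans_le hv)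
    rw [Complex.sub_re, abs_le] at hre
    rw [Complex.sub_im, abs_le] at him
    simp only at hre him
    refine ⟨v, Prod.ext ?_ ?_⟩
    · simp only [gridCell]
      rw [Int.floor_eq_iff, le_div_iff₀ h3, div_lt_iff₀ h3]
      constructor <;> linarith [hre.1, hre.2]
    · simp only [gridCell]
      rw [Int.floor_eq_iff, le_div_iff₀ h3, div_lt_iff₀ h3]
      constructor <;> linarith [him.1, him.2]
  choose rep hrep using hrep
  have hfib : ∀ p, (fun v : Γ.V => gridCell (3 * h) v) ⁻¹' {p} ⊆
      {v : Γ.V | dist (v : ℂ) (rep p) ≤ 6 * h} := by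
    intro p v hv
    have hv : gridCell (3 * h) v = p := hv
    have h1 : dist (v : ℂ) (rep p) < _ := dist_lt_of_near_gridCell (k := 0) h3 (by
      rw [hv, hrep]
      exact Near.refl _ _)
    push_cast at h1
    change dist (v : ℂ) (rep p) ≤ 6 * h
    linarith
  refine ⟨fun v => gridCell (3 * h) v, rep, hrep, ?_, ?_, ?_, by omega, ?_⟩
  · intro u v huv
    refine near_gridCell h3 ?_
    have := H.dist_le_of_adj huv
    push_cast
    linarith
  · exact fun p => (hM Γ h hh H hs (rep p)).1.subset (hfib p)
  · exact fun p => (ncard_le_ncard (hfib p) (hM Γ h hh H hs (rep p)).1).trans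
      (hM Γ h hh H hs (rep p)).2
  · intro u v k huv
    have h1 := dist_lt_of_near_gridCell h3 huv
    refine (hD Γ h hh H hs u v (6 * (k + 1)) ?_).trans ?_
    · push_cast
      linarith
    · have : D * (6 * (k + 1) + 1) ≤ (7 * D + 1) * (k + 1) := by nlinarith
      exact_mod_cast this

theorem weight_nonneg (u v : Γ.V) : 0 ≤ Γ.weight u v := by
  unfold weight
  split_ifs
  · exact div_nonneg diam_nonneg dist_nonneg
  · exact le_rfl

theorem IsIsoradial.le_weight (H : Γ.IsIsoradial h) {c : ℝ} (hc : 0 ≤ c) {u v : Γ.V}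
    (huv : Γ.graph.Adj u v) (hdual : c * h ≤ Γ.dualLength u v) : c ≤ Γ.weight u v := by
  have hne : (u : ℂ) ≠ v := fun h0 => huv.ne (Subtype.ext h0)
  unfold weight
  rw [if_pos huv, le_div_iff₀ (dist_pos.2 hne)]
  exact (mul_le_mul_of_nonneg_left (H.dist_le_of_adj huv) hc).trans hdual

theorem IsIsoradial.weight_le (H : Γ.IsIsoradial h) (hh : 0 < h) {κ : ℝ} (hκ : 0 < κ)
    (hs : ∀ u v : Γ.V, Γ.graph.Adj u v → κ * h ≤ dist (u : ℂ) v) (u v : Γ.V) :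
    Γ.weight u v ≤ 1 / κ := by
  unfold weight
  split_ifs with huv
  · have h1 := hs u v huv
    have h2 : 0 < κ * h := by positivity
    rw [div_le_div_iff₀ (by linarith) hκ, one_mul]
    nlinarith [H.dualLength_le hh.le u v]
  · positivity

end PlaneGraph

/-! ### Volume growth and Poincaré inequality for isoradial graphs -/

theorem lemma3p7 (Γ : ℝ → PlaneGraph) (hiso : ∀ h : ℝ, 0 < h → (Γ h).IsIsoradial h)
    (hprimal : PrimalEdgeBound Γ) (hdual : DualEdgeBound Γ) :
    (∃ c₁ c₂ : ℝ, 0 < c₁ ∧ 0 < c₂ ∧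
      ∀ n : ℕ, 1 ≤ n → ∀ h : ℝ, 0 < h → ∀ u : (Γ h).V,
        c₁ * (n : ℝ) ^ 2 ≤ (Γ h).vol u n ∧ (Γ h).vol u n ≤ c₂ * (n : ℝ) ^ 2) ∧
    (∃ C_P : ℝ, 0 < C_P ∧
      ∀ n : ℕ, 1 ≤ n → ∀ h : ℝ, 0 < h → ∀ (u : (Γ h).V) (f : (Γ h).V → ℝ),
        ∑ᶠ v ∈ (Γ h).ball u n, (Γ h).mass v * (f v - (Γ h).mean f u n) ^ 2 ≤
          C_P * (n : ℝ) ^ 2 *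
            ∑ᶠ v ∈ (Γ h).ball u (2 * n), ∑ᶠ w ∈ (Γ h).ball u (2 * n),
              (Γ h).weight v w * (f w - f v) ^ 2) := by
  obtain ⟨κ, hκ, hs⟩ := hprimal
  obtain ⟨c, hc, hdual⟩ := hdual
  obtain ⟨M, D, hMD⟩ := PlaneGraph.exists_isLatticeLike hκ
  obtain ⟨C, hC, hP⟩ := exists_poincare_constant M D hc
  have hfin : ∀ h, 0 < h → ∀ (u : (Γ h).V) (n : ℕ), ((Γ h).ball u n).Finite := by
    intro h hh u n
    obtain ⟨cell, rep, H⟩ := hMD (Γ h) h hh (hiso h hh) (hs h hh)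
    exact H.finite_ball u n
  have hncard : ∀ h, 0 < h → ∀ (u : (Γ h).V) (n : ℕ), 1 ≤ n →
      (((Γ h).ball u n).ncard : ℝ) ≤ 9 * M * n ^ 2 := by
    intro h hh u n hn
    obtain ⟨cell, rep, H⟩ := hMD (Γ h) h hh (hiso h hh) (hs h hh)
    have hn' : (1 : ℝ) ≤ n := by exact_mod_cast hn
    calc (((Γ h).ball u n).ncard : ℝ) ≤ (((2 * n + 1) ^ 2 * M : ℕ) : ℝ) := by
          exact_mod_cast H.ncard_ball_le u n
      _ = (2 * n + 1) ^ 2 * M := by push_cast; ring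
      _ ≤ (3 * n) ^ 2 * M := by
        gcongr
        linarith
      _ = 9 * M * n ^ 2 := by ring
  -- bounds for the vertex weights
  have hsub : ∀ h, ∀ u : (Γ h).V, (Γ h).graph.neighborSet u ⊆ (Γ h).ball u 1 := by
    intro h u v hv
    have hv : (Γ h).graph.Adj u v := hv
    exact SimpleGraph.edist_le_coe_iff.2 ⟨hv.symm.toWalk, by simp⟩
  have hmass : ∀ h, 0 < h → ∀ u : (Γ h).V, c ≤ (Γ h).mass u ∧ (Γ h).mass u ≤ 9 * M * (1 / κ) := by
    intro h hh u
    have hnfin := (hfin h hh u 1).subset (hsub h u)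
    unfold PlaneGraph.mass
    rw [finsum_mem_eq_finite_toFinset_sum _ hnfin]
    constructor
    · obtain ⟨v, hv⟩ := (hiso h hh).exists_adj u
      refine ((hiso h hh).le_weight hc.le hv (hdual h hh u v hv)).trans ?_
      exact Finset.single_le_sum (f := fun z => (Γ h).weight u z)
        (fun z _ => PlaneGraph.weight_nonneg u z) (hnfin.mem_toFinset.2 hv)
    · refine (Finset.sum_le_card_nsmul _ _ (1 / κ)
        fun z _ => (hiso h hh).weight_le hh hκ (hs h hh) u z).trans ?_
      rw [nsmul_eq_mul, ← Set.ncard_eq_toFinset_card _ hnfin]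
      gcongr
      have h1 : (((Γ h).graph.neighborSet u).ncard : ℝ) ≤ ((Γ h).ball u 1).ncard := by
        exact_mod_cast Set.ncard_le_ncard (hsub h u) (hfin h hh u 1)
      simpa using h1.trans (hncard h hh u 1 le_rfl)
  have hvol : ∀ h, (hh : 0 < h) → ∀ (u : (Γ h).V) (n : ℕ),
      (Γ h).vol u n = ∑ v ∈ (hfin h hh u n).toFinset, (Γ h).mass v :=
    fun h hh u n => finsum_mem_eq_finite_toFinset_sum _ _
  have hlow : ∀ n : ℕ, 1 ≤ n → ∀ h, 0 < h → ∀ u : (Γ h).V,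
      c / (4 * D ^ 2) * (n : ℝ) ^ 2 ≤ (Γ h).vol u n := by
    intro n hn h hh u
    obtain ⟨cell, rep, H⟩ := hMD (Γ h) h hh (hiso h hh) (hs h hh)
    have h1 := Finset.card_nsmul_le_sum (hfin h hh u n).toFinset _ c fun v _ => (hmass h hh v).1
    rw [hvol h hh]
    refine le_trans ?_ h1
    rw [nsmul_eq_mul, ← Set.ncard_eq_toFinset_card _ (hfin h hh u n)]
    calc c / (4 * D ^ 2) * (n : ℝ) ^ 2 = n ^ 2 / (4 * D ^ 2) * c := by ring
      _ ≤ _ := by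
        gcongr
        exact H.le_ncard_ball u hn
  have hD : 0 < c / (4 * (D : ℝ) ^ 2) := by
    obtain ⟨cell, rep, H⟩ := hMD (Γ 1) 1 one_pos (hiso 1 one_pos) (hs 1 one_pos)
    have : (0 : ℝ) < D := by exact_mod_cast H.one_le
    positivity
  refine ⟨⟨c / (4 * D ^ 2), 9 * M * (1 / κ) * (9 * M) + 1, hD, by positivity,
    fun n hn h hh u => ⟨hlow n hn h hh u, ?_⟩⟩, C * (9 * M * (1 / κ) + 1), by positivity,
    fun n hn h hh u f => ?_⟩
  · rw [hvol h hh]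
    refine (Finset.sum_le_card_nsmul _ _ _ fun v _ => (hmass h hh v).2).trans ?_
    rw [nsmul_eq_mul, ← Set.ncard_eq_toFinset_card _ (hfin h hh u n)]
    have h1 : (0 : ℝ) ≤ 9 * M * (1 / κ) := by positivity
    have h2 : (0 : ℝ) ≤ (n : ℝ) ^ 2 := by positivity
    nlinarith [mul_le_mul_of_nonneg_right (hncard h hh u n hn) h1]
  · obtain ⟨cell, rep, H⟩ := hMD (Γ h) h hh (hiso h hh) (hs h hh)
    obtain ⟨a, ha⟩ := hP _ _ cell rep H (Γ h).weight PlaneGraph.weight_nonneg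
      (fun v w hvw => (hiso h hh).le_weight hc.le hvw (hdual h hh v w hvw)) f u n hn
      (hfin h hh u n).toFinset (hfin h hh u (2 * n)).toFinset
      (fun v => (hfin h hh u n).mem_toFinset) (fun v => (hfin h hh u (2 * n)).mem_toFinset)
    have hW : 0 < (Γ h).vol u n := by
      refine lt_of_lt_of_le ?_ (hlow n hn h hh u)
      have : (0 : ℝ) < n := by exact_mod_cast hn
      positivity
    have hmean : (Γ h).mean f u n = 1 / (∑ v ∈ (hfin h hh u n).toFinset, (Γ h).mass v) *
        ∑ v ∈ (hfin h hh u n).toFinset, (Γ h).mass v * f v := by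
      unfold PlaneGraph.mean
      rw [hvol h hh, finsum_mem_eq_finite_toFinset_sum _ (hfin h hh u n)]
    have hen : ∑ᶠ v ∈ (Γ h).ball u (2 * n), ∑ᶠ w ∈ (Γ h).ball u (2 * n),
        (Γ h).weight v w * (f w - f v) ^ 2 =
        energy (Γ h).weight f (hfin h hh u (2 * n)).toFinset := by
      unfold energy
      rw [finsum_mem_eq_finite_toFinset_sum _ (hfin h hh u (2 * n))]
      exact Finset.sum_congr rfl fun v _ =>
        finsum_mem_eq_finite_toFinset_sum _ (hfin h hh u (2 * n))
    have hE0 : 0 ≤ energy (Γ h).weight f (hfin h hh u (2 * n)).toFinset :=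
      energy_nonneg PlaneGraph.weight_nonneg
    rw [hen, hmean, finsum_mem_eq_finite_toFinset_sum _ (hfin h hh u n)]
    rw [hvol h hh] at hW
    calc _ ≤ ∑ v ∈ (hfin h hh u n).toFinset, (Γ h).mass v * (f v - a) ^ 2 :=
          sum_mul_sq_sub_mean_le _ _ _ hW a
      _ ≤ ∑ v ∈ (hfin h hh u n).toFinset, 9 * M * (1 / κ) * (f v - a) ^ 2 := by
          gcongr with v _
          exact (hmass h hh v).2
      _ = 9 * M * (1 / κ) * ∑ v ∈ (hfin h hh u n).toFinset, (f v - a) ^ 2 :=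
          (Finset.mul_sum _ _ _).symm
      _ ≤ (9 * M * (1 / κ) + 1) *
          (C * n ^ 2 * energy (Γ h).weight f (hfin h hh u (2 * n)).toFinset) := by
          gcongr
          linarith
      _ = _ := by ring
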